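/- **Setting.** Let $A>0$, $L>1$, $\alpha_0\in(0,1)$, $\beta_0\in(0,2)$, $\gamma_0\in(0,1)$ and $\lambda_1^0\in\mathbb R$ be given. *Domain.* For $r>0$ let $Q_{r,L}=\{x\in\mathbb R^3: x_1^2+x_2^2<r^2,\ |x_3|<Lr\}$. Let $\Omega\subset\mathbb{R}^3$ be a bounded domain with $|\Omega|\le A$ and $\overline\Omega=\bigcup_{j=1}^N\overline{D_j}$, where $D_1,\dots,D_N\subset\Omega$ are pairwise disjoint, open, connected and of Lipschitz class with constants $1,L$ (near every $P\in\partial D_j$, in rigid coordinates with $P=0$, $D_j\cap Q_{1,L}=\{x\in Q_{1,L}:x_3>h(x')\}$ with $h$ Lipschitz on the unit disc $B_1'$, $h(0)=0$, $\|h\|_{L^\infty(B_1')}+\mathrm{Lip}(h)\le L$). Let $\Sigma\subset\partial D_1\cap\partial\Omega$ be a flat, relatively open portion of $\partial\Omega$. For every $j\ne1$ there is a chain $D_{j_1}=D_1,\dots,D_{j_M}=D_j$ and flat sets $\Sigma_1=\Sigma$ and $\Sigma_k\subset\partial D_{j_{k-1}}\cap\partial D_{j_k}\cap\Omega$ ($2\le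 k\le M$), such that for every $1\le k\le M$ there are $P_k\in\Sigma_k$ and rigid coordinates with $P_k=0$ in which $\Sigma_k$, $D_{j_k}$ and (if $k\geq 2$) $D_{j_{k-1}}$ meet $Q_{1/3,L}$ in $\{x_3=0\}$, $\{x_3<0\}$ and $\{x_3>0\}$ respectively. *Coefficients.* For $\underline L=(\lambda_j,\mu_j,\rho_j)_{j\le N}\in\mathbb R^{3N}$ (with the maximum norm) put $\mathbb C_{\underline L}=\sum_j(\lambda_jI_3\otimes I_3+2\mu_j\mathbb I_{sym})\chi_{D_j}$, $\rho_{\underline L}=\sum_j\rho_j\chi_{D_j}$, and $$\mathcal A=\Big\{\underline L:\ \tfrac{\alpha_0}2<\mu_j<\tfrac2{\alpha_0},\ \lambda_j<\tfrac2{\alpha_0},\ 2\mu_j+3\lambda_j>\tfrac{\beta_0}2,\ \tfrac{\gamma_0}2<\rho_j<\tfrac2{\gamma_0}\ \ \forall j\Big\},$$ $$\mathbf K=\Big\{\underline L\in\mathcal A:\ \alpha_0\le\mu_j\le\alpha_0^{-1},\ \lambda_j\le\alpha_0^{-1},\ 2\mu_j+3\lambda_j\ge\beta_0,\ 0\le\rho_j\le\gamma_0^{-1}\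 \ \forall j\Big\}.$$ *Frequency.* $\lambda_1^0$ is the smallest Dirichlet eigenvalue of $-\operatorname{div}(\mathbb C_0\hat\nabla u)$ in $\Omega$, i.e. the minimum of $\int_\Omega\mathbb C_0\hat\nabla u:\hat\nabla u$ over $u\in H^1_0(\Omega;\mathbb{R}^3)$ with $\|u\|_{L^2}=1$, where $\mathbb C_0=\frac{\beta_0-3\alpha_0}2I_3\otimes I_3+2\alpha_0\mathbb I_{sym}$ and $\hat\nabla u=\frac12(\nabla u+(\nabla u)^T)$. The frequency $\omega\in\mathbb R$ satisfies $\omega^2\le\gamma_0\lambda_1^0/2$. *Spaces.* $H^{1/2}(\partial\Omega)$ is the space of traces $H^1(\Omega;\mathbb R^3)/H^1_0(\Omega;\mathbb R^3)$ with the quotient norm, $H^{1/2}_{co}(\Sigma)$ its subspace of traces with support in $\Sigma$, and $H^{-1/2}_{co}(\Sigma)$ the dual of $H^{1/2}_{co}(\Sigma)$. *Direct problem.* For $f\in H^{-1}(\Omega)=H^1_0(\Omega;\mathbb{R}^3)^*$ and $g\in H^{1/2}(\partial\Omega)$ consider weak solutions $u\in H^1(\Omega;\mathbb{R}^3)$ of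 $$\operatorname{div}(\mathbb C_{\underline L}\hat\nabla u)+\rho_{\underline L}\omega^2u=f\ \text{ in }\Omega,\qquad u=g\ \text{ on }\partial\Omega. \tag{1}$$ For $M\in\mathbb R$ let $\mathcal A_M$ be the set of $\underline L\in\mathcal A$ such that for all $f,g$ problem (1) has exactly one solution and it satisfies $\|u\|_{H^1(\Omega)}\le M(\|g\|_{H^{1/2}(\partial\Omega)}+\|f\|_{H^{-1}(\Omega)})$. Let $\mathcal A_{reg}=\bigcup_M\mathcal A_M$ be the set of $\underline L\in\mathcal A$ for which (1) is well posed. *Forward map.* For $\underline L\in\mathcal A_{reg}$, $F(\underline L)\in\mathcal L(H^{1/2}_{co}(\Sigma),H^{-1/2}_{co}(\Sigma))$ is the local Dirichlet-to-Neumann map $\psi\mapsto(\mathbb C_{\underline L}\hat\nabla u)\nu|_\Sigma$, i.e. $$\langle F(\underline L)\psi,\phi\rangle=\int_\Omega(\mathbb C_{\underline L}\hat\nabla u:\hat\nabla v-\rho_{\underline L}\omega^2u\cdot v)\,dx,$$ where $u$ solves (1) with $f=0$, $g=\psi$, and $v\in H^1(\Omega;\mathbb{R}^3)$ is any field with $v=\phi$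 on $\partial\Omega$. **Proposition.** There are $M_0$ and $C(M)$ (for $M\in\mathbb R$), depending only on $A,L,\alpha_0,\beta_0,\gamma_0,\lambda_1^0$, such that in this setting, for all $N,\Omega,D_j,\Sigma,\omega$: 1. $\mathcal A_{reg}$ is open, $F$ is well defined on it, and $F$ is Fréchet differentiable at every $\underline L\in\mathcal A_{reg}$, with $$\langle DF(\underline L)[\underline H]\psi,\phi\rangle=\int_\Omega\big(\mathbb H\hat\nabla u_{\underline L}:\hat\nabla v_{\underline L}-h\omega^2u_{\underline L}\cdot v_{\underline L}\big)dx,\qquad \mathbb H=\mathbb C_{\underline H},\ h=\rho_{\underline H},$$ for $\underline H\in\mathbb R^{3N}$ and $\psi,\phi\in H^{1/2}_{co}(\Sigma)$, where $u_{\underline L},v_{\underline L}$ solve (1) with $f=0$ and boundary values $\psi$, $\phi$. 2. $\mathbf K\subset\mathcal A_{M_0}$; and if $\omega^2\le\gamma_0\lambda_1^0/8$, then $\mathcal A=\mathcal A_{M_0}$. 3. For every $M$, $DF$ is Lipschitz continuous on $\mathcal A_M$ with constant $C(M)$. In particular $DF$ is Lipschitz continuous with constant $C_{DF}=C(M_0)$,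 depending only on the a priori data $A,L,\alpha_0,\beta_0,\gamma_0,\lambda_1^0$, on $\mathbf K$, and on all of $\mathcal A$ if $\omega^2\le\gamma_0\lambda_1^0/8$. -/

import Mathlib

open MeasureTheory Set Filter Topology

set_option maxSynthPendingDepth 3

noncomputable section

namespace Elastic

/-- Euclidean space `ℝ³`. -/
abbrev E3 : Type := EuclideanSpace ℝ (Fin 3)

/-- Real `3 × 3` arrays with the Frobenius norm: the values of displacement gradients. -/
abbrev Grad : Type := EuclideanSpace ℝ (Fin 3 × Fin 3)

/-! ### Sobolev spaces -/

/-- `L²(Ω; ℝ³) × L²(Ω; ℝ^{3×3})` as a Hilbert space,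
`‖(u, G)‖² = ‖u‖²_{L²} + ‖G‖²_{L²}`. -/
abbrev L2Pair (Ω : Set E3) : Type :=
  WithLp 2 (Lp E3 2 (volume.restrict Ω) × Lp Grad 2 (volume.restrict Ω))

/-- `G` is the weak (distributional) gradient of `u` in `Ω`: `G_{ij} = ∂_j u_i`. -/
def IsWeakGradient (Ω : Set E3) (u : E3 → E3) (G : E3 → Grad) : Prop :=
  ∀ θ : E3 → ℝ, ContDiff ℝ (⊤ : ℕ∞) θ → HasCompactSupport θ → tsupport θ ⊆ Ω →
    ∀ i j : Fin 3,
      ∫ x in Ω, u x i * fderiv ℝ θ x (EuclideanSpace.single j 1) = - ∫ x in Ω, G x (i, j) * θ x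

theorem integrable_coord_mul {ι : Type} [Fintype ι] (Ω : Set E3)
    (u : Lp (EuclideanSpace ℝ ι) 2 (volume.restrict Ω)) (i : ι) {θ : E3 → ℝ}
    (hθ : Continuous θ) (hc : HasCompactSupport θ) :
    Integrable (fun x => u x i * θ x) (volume.restrict Ω) := by
  have h1 : MemLp (fun x => u x i) 2 (volume.restrict Ω) :=
    (EuclideanSpace.proj (𝕜 := ℝ) i).comp_memLp' (Lp.memLp u)
  have h2 : MemLp θ 2 (volume.restrict Ω) := hθ.memLp_of_hasCompactSupport hc
  exact h1.integrable_mul h2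

theorem continuous_partial {θ : E3 → ℝ} (hθ : ContDiff ℝ (⊤ : ℕ∞) θ) (j : Fin 3) :
    Continuous fun x => fderiv ℝ θ x (EuclideanSpace.single j 1) :=
  (hθ.continuous_fderiv (by simp)).clm_apply continuous_const

theorem hasCompactSupport_partial {θ : E3 → ℝ} (hc : HasCompactSupport θ) (j : Fin 3) :
    HasCompactSupport fun x => fderiv ℝ θ x (EuclideanSpace.single j 1) :=
  hc.fderiv_apply (𝕜 := ℝ) _

/-- The Sobolev space `H¹(Ω; ℝ³)`: pairs `(u, ∇u)` of an `L²` field and its `L²` weak gradient,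
with norm `‖u‖²_{H¹} = ‖u‖²_{L²} + ‖∇u‖²_{L²}`. -/
def H1 (Ω : Set E3) : Submodule ℝ (L2Pair Ω) where
  carrier := {w | IsWeakGradient Ω w.fst w.snd}
  zero_mem' := by
    intro θ _ _ _ i j
    have h1 : (fun x => (((0 : L2Pair Ω).fst : E3 → E3) x) i *
        fderiv ℝ θ x (EuclideanSpace.single j 1)) =ᵐ[volume.restrict Ω] 0 := by
      filter_upwards [Lp.coeFn_zero E3 2 (volume.restrict Ω)] with x hx
      rw [WithLp.zero_fst, hx]
      simp
    have h2 : (fun x => (((0 : L2Pair Ω).snd : E3 → Grad) x) (i, j) * θ x)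
        =ᵐ[volume.restrict Ω] 0 := by
      filter_upwards [Lp.coeFn_zero Grad 2 (volume.restrict Ω)] with x hx
      rw [WithLp.zero_snd, hx]
      simp
    rw [integral_congr_ae h1, integral_congr_ae h2]
    simp
  add_mem' := by
    intro a b ha hb θ hθ hc hs i j
    have h1 : (fun x => (((a + b).fst : E3 → E3) x) i *
        fderiv ℝ θ x (EuclideanSpace.single j 1)) =ᵐ[volume.restrict Ω]
        fun x => (a.fst x i * fderiv ℝ θ x (EuclideanSpace.single j 1)) +
          (b.fst x i * fderiv ℝ θ x (EuclideanSpace.single j 1)) := by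
      filter_upwards [Lp.coeFn_add a.fst b.fst] with x hx
      rw [WithLp.add_fst, hx]
      simp [add_mul]
    have h2 : (fun x => (((a + b).snd : E3 → Grad) x) (i, j) * θ x) =ᵐ[volume.restrict Ω]
        fun x => (a.snd x (i, j) * θ x) + (b.snd x (i, j) * θ x) := by
      filter_upwards [Lp.coeFn_add a.snd b.snd] with x hx
      rw [WithLp.add_snd, hx]
      simp [add_mul]
    rw [integral_congr_ae h1, integral_congr_ae h2,
      integral_add (integrable_coord_mul Ω a.fst i (continuous_partial hθ j)
        (hasCompactSupport_partial hc j))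
        (integrable_coord_mul Ω b.fst i (continuous_partial hθ j)
        (hasCompactSupport_partial hc j)),
      integral_add (integrable_coord_mul Ω a.snd (i, j) hθ.continuous hc)
        (integrable_coord_mul Ω b.snd (i, j) hθ.continuous hc),
      ha θ hθ hc hs i j, hb θ hθ hc hs i j]
    ring
  smul_mem' := by
    intro c a ha θ hθ hc hs i j
    have h1 : (fun x => (((c • a).fst : E3 → E3) x) i *
        fderiv ℝ θ x (EuclideanSpace.single j 1)) =ᵐ[volume.restrict Ω]
        fun x => c * (a.fst x i * fderiv ℝ θ x (EuclideanSpace.single j 1)) := by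
      filter_upwards [Lp.coeFn_smul c a.fst] with x hx
      rw [WithLp.smul_fst, hx]
      simp [mul_assoc]
    have h2 : (fun x => (((c • a).snd : E3 → Grad) x) (i, j) * θ x) =ᵐ[volume.restrict Ω]
        fun x => c * (a.snd x (i, j) * θ x) := by
      filter_upwards [Lp.coeFn_smul c a.snd] with x hx
      rw [WithLp.smul_snd, hx]
      simp [mul_assoc]
    rw [integral_congr_ae h1, integral_congr_ae h2, integral_const_mul, integral_const_mul,
      ha θ hθ hc hs i j]
    ring

/-- The displacement field `u` of an element of `H¹(Ω; ℝ³)`. -/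
def field {Ω : Set E3} (u : H1 Ω) : Lp E3 2 (volume.restrict Ω) := (u : L2Pair Ω).fst

/-- The weak gradient of an element of `H¹(Ω; ℝ³)`, as a matrix field: `(∇u)_{ij} = ∂_j u_i`. -/
def grad {Ω : Set E3} (u : H1 Ω) (x : E3) : Matrix (Fin 3) (Fin 3) ℝ :=
  Matrix.of fun i j => ((u : L2Pair Ω).snd : E3 → Grad) x (i, j)

/-- The strain `∇̂u = (∇u + (∇u)ᵀ) / 2`. -/
def strain {Ω : Set E3} (u : H1 Ω) (x : E3) : Matrix (Fin 3) (Fin 3) ℝ :=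
  (1 / 2 : ℝ) • (grad u x + (grad u x).transpose)

/-- `H¹₀(Ω; ℝ³)`: the closure in `H¹` of the smooth fields with compact support in `Ω`. -/
def H10 (Ω : Set E3) : Submodule ℝ (H1 Ω) :=
  (Submodule.span ℝ {u : H1 Ω | ∃ Φ : E3 → E3, ContDiff ℝ (⊤ : ℕ∞) Φ ∧ HasCompactSupport Φ ∧
    tsupport Φ ⊆ Ω ∧ (field u : E3 → E3) =ᵐ[volume.restrict Ω] Φ}).topologicalClosure

instance isClosed_H10 (Ω : Set E3) : IsClosed (H10 Ω : Set (H1 Ω)) :=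
  Submodule.isClosed_topologicalClosure _

/-- `H^{1/2}(∂Ω; ℝ³)`: the space of traces of `H¹` fields. A trace is a class of `H¹` fields
modulo `H¹₀`, and its norm is the least `H¹` norm of an extension (the quotient norm). -/
def TraceSpace (Ω : Set E3) : Type := H1 Ω ⧸ H10 Ω

instance traceNormedAddCommGroup (Ω : Set E3) : NormedAddCommGroup (TraceSpace Ω) :=
  inferInstanceAs (NormedAddCommGroup (H1 Ω ⧸ H10 Ω))

instance traceNormedSpace (Ω : Set E3) : NormedSpace ℝ (TraceSpace Ω) :=
  inferInstanceAs (NormedSpace ℝ (H1 Ω ⧸ H10 Ω))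

/-- The trace `u|_{∂Ω}`. -/
def trace {Ω : Set E3} : H1 Ω →ₗ[ℝ] TraceSpace Ω := (H10 Ω).mkQ

/-- The support of a trace: the boundary points near which it is not zero. The trace is zero near
`x` if it is the trace of a field that vanishes in a neighbourhood of `x` in `Ω`. -/
def traceSupport {Ω : Set E3} (φ : TraceSpace Ω) : Set E3 :=
  {x | x ∈ frontier Ω ∧ ¬ ∃ u : H1 Ω, trace u = φ ∧ ∃ U ∈ 𝓝 x,
    ∀ᵐ y ∂(volume.restrict Ω), y ∈ U → field u y = 0}

/-- `H^{1/2}_{co}(S)`: the traces whose support lies in the boundary portion `S`, with the norm of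
`H^{1/2}(∂Ω)`. -/
def Hco (Ω S : Set E3) : Submodule ℝ (TraceSpace Ω) where
  carrier := {φ | traceSupport φ ⊆ S}
  zero_mem' := by
    rintro x ⟨_, hx⟩
    refine absurd ⟨0, by simp, univ, univ_mem, ?_⟩ hx
    filter_upwards [Lp.coeFn_zero E3 2 (volume.restrict Ω)] with y hy _
    have : (field (0 : H1 Ω) : E3 → E3) y = (0 : Lp E3 2 (volume.restrict Ω)) y := rfl
    rw [this, hy]
    rfl
  add_mem' := by
    intro a b ha hb x hx
    by_contra hxS
    have hna : x ∉ traceSupport a := fun h => hxS (ha h)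
    have hnb : x ∉ traceSupport b := fun h => hxS (hb h)
    simp only [traceSupport, mem_ofPred_eq, not_and, not_not] at hna hnb
    obtain ⟨u, hu, U, hU, hu0⟩ := hna hx.1
    obtain ⟨v, hv, V, hV, hv0⟩ := hnb hx.1
    refine hx.2 ⟨u + v, ?_, U ∩ V, inter_mem hU hV, ?_⟩
    · rw [← hu, ← hv]; simp
    · filter_upwards [hu0, hv0, Lp.coeFn_add (field u) (field v)] with y h1 h2 h3 hy
      have : (field (u + v) : E3 → E3) y = (field u + field v : Lp E3 2 (volume.restrict Ω)) y :=
        rfl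
      rw [this, h3]
      simp [h1 hy.1, h2 hy.2]
  smul_mem' := by
    intro c a ha x hx
    by_contra hxS
    have hna : x ∉ traceSupport a := fun h => hxS (ha h)
    simp only [traceSupport, mem_ofPred_eq, not_and, not_not] at hna
    obtain ⟨u, hu, U, hU, hu0⟩ := hna hx.1
    refine hx.2 ⟨c • u, ?_, U, hU, ?_⟩
    · rw [← hu]; simp
    · filter_upwards [hu0, Lp.coeFn_smul c (field u)] with y h1 h3 hy
      have : (field (c • u) : E3 → E3) y = (c • field u : Lp E3 2 (volume.restrict Ω)) y := rfl
      rw [this, h3]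
      simp [h1 hy]

/-- `H^{-1/2}_{co}(S)`: the topological dual of `H^{1/2}_{co}(S)`. -/
abbrev HcoDual (Ω S : Set E3) : Type := StrongDual ℝ (Hco Ω S)

/-! ### Geometry -/

/-- The cylinder `Q_{r,L} = B'_r × (-L r, L r)`. -/
def cylinder (r L : ℝ) : Set E3 := {x | x 0 ^ 2 + x 1 ^ 2 < r ^ 2 ∧ |x 2| < L * r}

/-- `S ⊆ ∂D` is of Lipschitz class with constants `r₀, L`: near every point of `S`, in suitable
rigid coordinates, `D` is the region above the graph of a function `h` with
`‖h‖_∞ + r₀ Lip(h) ≤ L r₀`. -/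
def IsLipschitzPortion (D S : Set E3) (r₀ L : ℝ) : Prop :=
  ∀ P ∈ S, ∃ T : E3 ≃ᵃⁱ[ℝ] E3, T P = 0 ∧
    ∃ (h : EuclideanSpace ℝ (Fin 2) → ℝ) (m K : ℝ), h 0 = 0 ∧
      (∀ y ∈ Metric.ball (0 : EuclideanSpace ℝ (Fin 2)) r₀, |h y| ≤ m) ∧
      (∀ y ∈ Metric.ball (0 : EuclideanSpace ℝ (Fin 2)) r₀,
        ∀ z ∈ Metric.ball (0 : EuclideanSpace ℝ (Fin 2)) r₀, |h y - h z| ≤ K * ‖y - z‖) ∧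
      m + r₀ * K ≤ L * r₀ ∧
      T '' D ∩ cylinder r₀ L = {x | x ∈ cylinder r₀ L ∧ h !₂[x 0, x 1] < x 2}

/-- `D` is of Lipschitz class with constants `r₀, L`. -/
def IsLipschitzDomain (D : Set E3) (r₀ L : ℝ) : Prop := IsLipschitzPortion D (frontier D) r₀ L

/-- `S` lies in a plane. -/
def IsFlat (S : Set E3) : Prop := ∃ T : E3 ≃ᵃⁱ[ℝ] E3, ∀ x ∈ S, T x 2 = 0

/-- The assumption on the domain and its partition: `Ω` is a bounded domain with `|Ω| ≤ A`,
`Ω̄ = ⋃ D̄_j` with pairwise non-overlapping subdomains `D_j` of Lipschitz class with constants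
`1, L`; `S` is a flat open portion of `∂Ω` contained in `∂D_{j₁} ∩ ∂Ω`; and every other `D_j` is
joined to `D_{j₁}` by a chain `D_{c 0} = D_{j₁}, …, D_{c m} = D_j`, with flat interfaces
`Γ k` (`Γ 0 = S`) that contain a full flat disc in the cylinder of size `1/3, L` around one of
their points. -/
structure IsPartition (A L : ℝ) {N : ℕ} (Ω : Set E3) (D : Fin N → Set E3) (j₁ : Fin N)
    (S : Set E3) : Prop where
  isOpen : IsOpen Ω
  isConnected : IsConnected Ω
  isBounded : Bornology.IsBounded Ω
  volume_le : volume Ω ≤ ENNReal.ofReal A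
  isOpen_sub : ∀ j, IsOpen (D j)
  isConnected_sub : ∀ j, IsConnected (D j)
  sub_subset : ∀ j, D j ⊆ Ω
  disjoint_sub : ∀ j k, j ≠ k → Disjoint (D j) (D k)
  lipschitz_sub : ∀ j, IsLipschitzDomain (D j) 1 L
  closure_eq : closure Ω = ⋃ j, closure (D j)
  portion_open : ∃ U : Set E3, IsOpen U ∧ S = U ∩ frontier Ω
  portion_subset : S ⊆ frontier (D j₁) ∩ frontier Ω
  portion_flat : IsFlat S
  chain : ∀ j, j ≠ j₁ → ∃ (m : ℕ) (c : ℕ → Fin N) (Γ : ℕ → Set E3),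
    c 0 = j₁ ∧ c m = j ∧ Γ 0 = S ∧
    (∀ k < m, Γ (k + 1) ⊆ frontier (D (c k)) ∩ frontier (D (c (k + 1))) ∧
      Γ (k + 1) ⊆ Ω ∧ IsFlat (Γ (k + 1))) ∧
    ∀ k ≤ m, ∃ P ∈ Γ k, ∃ T : E3 ≃ᵃⁱ[ℝ] E3, T P = 0 ∧
      T '' Γ k ∩ cylinder (1 / 3) L = {x | x ∈ cylinder (1 / 3) L ∧ x 2 = 0} ∧
      T '' D (c k) ∩ cylinder (1 / 3) L = {x | x ∈ cylinder (1 / 3) L ∧ x 2 < 0} ∧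
      (0 < k →
        T '' D (c (k - 1)) ∩ cylinder (1 / 3) L = {x | x ∈ cylinder (1 / 3) L ∧ 0 < x 2})

/-! ### Parameters and the elastic form -/

/-- Parameter vectors `(λ, μ, ρ) ∈ ℝ^{3N}`, with the maximum norm. -/
abbrev Params (N : ℕ) : Type := (Fin N → ℝ) × (Fin N → ℝ) × (Fin N → ℝ)

/-- The admissible set `𝒜`. -/
def admissible (N : ℕ) (α₀ β₀ γ₀ : ℝ) : Set (Params N) :=
  {p | ∀ j, α₀ / 2 < p.2.1 j ∧ p.2.1 j < 2 / α₀ ∧ p.1 j < 2 / α₀ ∧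
    β₀ / 2 < 2 * p.2.1 j + 3 * p.1 j ∧ γ₀ / 2 < p.2.2 j ∧ p.2.2 j < 2 / γ₀}

/-- The subset `𝐊` of `𝒜` cut out by the a priori bounds. -/
def aprioriSet (N : ℕ) (α₀ β₀ γ₀ : ℝ) : Set (Params N) :=
  {p | p ∈ admissible N α₀ β₀ γ₀ ∧
    ∀ j, α₀ ≤ p.2.1 j ∧ p.2.1 j ≤ α₀⁻¹ ∧ p.1 j ≤ α₀⁻¹ ∧
      β₀ ≤ 2 * p.2.1 j + 3 * p.1 j ∧ 0 ≤ p.2.2 j ∧ p.2.2 j ≤ γ₀⁻¹}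

/-- The piecewise constant function `∑_j c_j χ_{D_j}`. -/
def piecewiseConst {N : ℕ} (D : Fin N → Set E3) (c : Fin N → ℝ) (x : E3) : ℝ :=
  ∑ j, (D j).indicator (fun _ => c j) x

/-- The isotropic stiffness tensor `ℂ = lam I ⊗ I + 2 mu 𝕀_sym` applied to a matrix. -/
def stiffness (lam mu : ℝ) (B : Matrix (Fin 3) (Fin 3) ℝ) : Matrix (Fin 3) (Fin 3) ℝ :=
  (lam * B.trace) • (1 : Matrix (Fin 3) (Fin 3) ℝ) +
    (2 * mu) • ((1 / 2 : ℝ) • (B + B.transpose))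

/-- `B : B' = ∑ B_{ij} B'_{ij}`. -/
def contract (B B' : Matrix (Fin 3) (Fin 3) ℝ) : ℝ := ∑ i, ∑ j, B i j * B' i j

/-- `∫_Ω (ℂ_p ∇̂u : ∇̂v - ρ_p ω² u · v) dx`. -/
def form {N : ℕ} {Ω : Set E3} (D : Fin N → Set E3) (ω : ℝ) (p : Params N) (u v : H1 Ω) : ℝ :=
  ∫ x in Ω, (contract
      (stiffness (piecewiseConst D p.1 x) (piecewiseConst D p.2.1 x) (strain u x)) (strain v x)
    - piecewiseConst D p.2.2 x * ω ^ 2 * inner ℝ (field u x) (field v x))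

/-- The smallest Dirichlet eigenvalue `λ₁⁰` in `Ω` of `-div(ℂ₀ ∇̂u)`, where
`ℂ₀ = (β₀ - 3 α₀)/2 I ⊗ I + 2 α₀ 𝕀_sym`: the minimum of `∫ ℂ₀ ∇̂u : ∇̂u` over `u ∈ H¹₀` with
`‖u‖_{L²} = 1`. -/
def firstEigenvalue (Ω : Set E3) (α₀ β₀ : ℝ) : ℝ :=
  sInf {r | ∃ u ∈ H10 Ω, ‖field u‖ = 1 ∧
    r = ∫ x in Ω, contract (stiffness ((β₀ - 3 * α₀) / 2) α₀ (strain u x)) (strain u x)}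

/-! ### The direct problem and the forward map -/

section Direct

variable {N : ℕ} {Ω : Set E3}

/-- `u ∈ H¹(Ω)` is a weak solution of `div(ℂ_p ∇̂u) + ρ_p ω² u = f` in `Ω`, `u = g` on `∂Ω`,
where `f ∈ H⁻¹(Ω)`, the dual of `H¹₀(Ω)`. -/
def IsWeakSolution (D : Fin N → Set E3) (ω : ℝ) (p : Params N) (f : StrongDual ℝ (H10 Ω))
    (g : TraceSpace Ω) (u : H1 Ω) : Prop :=
  trace u = g ∧ ∀ v : H10 Ω, form D ω p u v = - f v

/-- The direct problem is well posed with constant `M`: for all `f ∈ H⁻¹(Ω)` and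
`g ∈ H^{1/2}(∂Ω)` there is exactly one weak solution, and
`‖u‖_{H¹} ≤ M (‖g‖_{H^{1/2}} + ‖f‖_{H⁻¹})`. -/
def WellPosedWith (Ω : Set E3) (D : Fin N → Set E3) (ω : ℝ) (M : ℝ) (p : Params N) : Prop :=
  ∀ (f : StrongDual ℝ (H10 Ω)) (g : TraceSpace Ω),
    (∃! u : H1 Ω, IsWeakSolution D ω p f g u) ∧
    ∀ u : H1 Ω, IsWeakSolution D ω p f g u → ‖u‖ ≤ M * (‖g‖ + ‖f‖)

/-- `T` is the local Dirichlet-to-Neumann map `ψ ↦ (ℂ_p ∇̂u) ν` on `S`, where `u` solves the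
homogeneous equation with `u = ψ` on `∂Ω`; the conormal derivative is taken in the weak sense:
`⟨T ψ, φ⟩ = ∫ (ℂ_p ∇̂u : ∇̂v - ρ_p ω² u · v)` for every `v ∈ H¹(Ω)` with `v = φ` on `∂Ω`. -/
def IsLocalDNMap (D : Fin N → Set E3) (ω : ℝ) (S : Set E3) (p : Params N)
    (T : Hco Ω S →L[ℝ] HcoDual Ω S) : Prop :=
  ∀ (ψ φ : Hco Ω S) (u v : H1 Ω), IsWeakSolution D ω p 0 ψ u → trace v = φ →
    T ψ φ = form D ω p u v

open Classical in
/-- The forward map `F`, sending `p` to the local Dirichlet-to-Neumann map of `(ℂ_p, ρ_p)`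
(and to `0` if there is none). -/
def forwardMap (Ω : Set E3) (D : Fin N → Set E3) (ω : ℝ) (S : Set E3) (p : Params N) :
    Hco Ω S →L[ℝ] HcoDual Ω S :=
  if h : ∃ T : Hco Ω S →L[ℝ] HcoDual Ω S, IsLocalDNMap D ω S p T then h.choose else 0

/-- The admissible parameters for which the direct problem is well posed with constant `M`. -/
def regularWith (Ω : Set E3) (D : Fin N → Set E3) (ω α₀ β₀ γ₀ M : ℝ) : Set (Params N) :=
  {p | p ∈ admissible N α₀ β₀ γ₀ ∧ WellPosedWith Ω D ω M p}

/-- The admissible parameters for which the direct problem is well posed, that is, for which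
`ω` is not an eigenfrequency. -/
def regular (Ω : Set E3) (D : Fin N → Set E3) (ω α₀ β₀ γ₀ : ℝ) : Set (Params N) :=
  {p | ∃ M, p ∈ regularWith Ω D ω α₀ β₀ γ₀ M}

end Direct

end Elastic

end

/-! ### Well-posedness of symmetric variational problems -/

namespace Variational

section

variable {V W P : Type*} [NormedAddCommGroup V] [NormedSpace ℝ V]
  [NormedAddCommGroup W] [NormedSpace ℝ W] [NormedAddCommGroup P] [NormedSpace ℝ P]

/-- `u` solves `b(u, ·) = -f` on `V₀` with boundary value `τ u = g`. -/
def IsSolution (V₀ : Submodule ℝ V) (τ : V →ₗ[ℝ] W) (b : V →L[ℝ] V →L[ℝ] ℝ)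
    (f : StrongDual ℝ V₀) (g : W) (u : V) : Prop :=
  τ u = g ∧ ∀ v : V₀, b u v = -f v

/-- Well-posedness with constant `M` of the boundary value problem for `b`. -/
def WellPosed (V₀ : Submodule ℝ V) (τ : V →ₗ[ℝ] W) (M : ℝ) (b : V →L[ℝ] V →L[ℝ] ℝ) : Prop :=
  ∀ (f : StrongDual ℝ V₀) (g : W), (∃! u : V, IsSolution V₀ τ b f g u) ∧
    ∀ u : V, IsSolution V₀ τ b f g u → ‖u‖ ≤ M * (‖g‖ + ‖f‖)

/-- The operator `V₀ → V₀*` of the form `b`. -/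
noncomputable def restrictForm (V₀ : Submodule ℝ V) :
    (V →L[ℝ] V →L[ℝ] ℝ) →L[ℝ] V₀ →L[ℝ] StrongDual ℝ V₀ :=
  LinearMap.mkContinuous
    { toFun := fun b => b.bilinearComp V₀.subtypeL V₀.subtypeL
      map_add' := fun _ _ => rfl
      map_smul' := fun _ _ => rfl } 1 (by
    intro b
    rw [one_mul]
    refine ContinuousLinearMap.opNorm_le_bound₂ _ (norm_nonneg _) fun u v => ?_
    exact b.le_opNorm₂ (u : V) (v : V))

@[simp] theorem restrictForm_apply (V₀ : Submodule ℝ V) (b : V →L[ℝ] V →L[ℝ] ℝ) (u v : V₀) :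
    restrictForm V₀ b u v = b u v := rfl

/-- Every boundary value has extensions of almost the same norm, and the fields with zero boundary
value are those in `V₀`. -/
structure IsTrace (V₀ : Submodule ℝ V) (τ : V →ₗ[ℝ] W) : Prop where
  ker : ∀ u, τ u = 0 ↔ u ∈ V₀
  lift : ∀ g : W, ∀ ε > 0, ∃ v, τ v = g ∧ ‖v‖ < ‖g‖ + ε

variable {V₀ : Submodule ℝ V} {τ : V →ₗ[ℝ] W}

theorem wellPosed_of_equiv (hτ : IsTrace V₀ τ) {b : V →L[ℝ] V →L[ℝ] ℝ}
    (e : V₀ ≃L[ℝ] StrongDual ℝ V₀) (he : (e : V₀ →L[ℝ] StrongDual ℝ V₀) = restrictForm V₀ b)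
    {K B : ℝ} (hK0 : 0 ≤ K) (hK : ∀ f, ‖e.symm f‖ ≤ K * ‖f‖) (hB : ‖b‖ ≤ B) :
    WellPosed V₀ τ (1 + K * (1 + B)) b := by
  have he' : ∀ u v : V₀, e u v = b u v := fun u v => by
    rw [← restrictForm_apply, ← he]; rfl
  have hB0 : 0 ≤ B := (norm_nonneg _).trans hB
  have huniq : ∀ (f : StrongDual ℝ V₀) (g : W) (u u' : V), IsSolution V₀ τ b f g u →
      IsSolution V₀ τ b f g u' → u = u' := by
    intro f g u u' hu hu'
    have hmem : u - u' ∈ V₀ := (hτ.ker _).1 (by rw [map_sub, hu.1, hu'.1, sub_self])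
    have : e ⟨u - u', hmem⟩ = 0 := by
      ext v
      rw [he']
      simp [hu.2 v, hu'.2 v]
    have := (map_eq_zero_iff e e.injective).1 this
    exact sub_eq_zero.1 (congrArg Subtype.val this)
  have hex : ∀ (f : StrongDual ℝ V₀) (g : W) (w : V), τ w = g →
      ∃ u, IsSolution V₀ τ b f g u ∧ ‖u‖ ≤ ‖w‖ + K * (‖f‖ + B * ‖w‖) := by
    intro f g w hw
    set F : StrongDual ℝ V₀ := -f - (b w).comp V₀.subtypeL with hF
    refine ⟨w + e.symm F, ⟨?_, ?_⟩, ?_⟩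
    · rw [map_add, hw, (hτ.ker _).2 (e.symm F).2, add_zero]
    · intro v
      have h1 : b (e.symm F) v = F v := by rw [← he', e.apply_symm_apply]
      rw [map_add, add_apply, h1, hF]
      simp
    · have h2 : ‖F‖ ≤ ‖f‖ + B * ‖w‖ := by
        refine (norm_sub_le _ _).trans ?_
        rw [norm_neg]
        gcongr
        refine ContinuousLinearMap.opNorm_le_bound _ (by positivity) fun v => ?_
        refine (b.le_opNorm₂ w v).trans ?_
        gcongr
        rfl
      calc ‖w + e.symm F‖ ≤ ‖w‖ + ‖e.symm F‖ := norm_add_le _ _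
        _ ≤ ‖w‖ + K * ‖F‖ := by gcongr; exact hK F
        _ ≤ _ := by gcongr
  intro f g
  refine ⟨?_, ?_⟩
  · obtain ⟨w, hw, -⟩ := hτ.lift g 1 one_pos
    obtain ⟨u, hu, -⟩ := hex f g w hw
    exact ⟨u, hu, fun u' hu' => huniq f g u' u hu' hu⟩
  · intro u hu
    have key : ∀ ε > 0, ‖u‖ ≤ (1 + K * (1 + B)) * (‖g‖ + ‖f‖) + (1 + K * B) * ε := by
      intro ε hε
      obtain ⟨w, hw, hwn⟩ := hτ.lift g ε hε
      obtain ⟨u', hu', hn⟩ := hex f g w hw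
      rw [huniq f g u u' hu hu']
      have h1 : ‖u'‖ ≤ (‖g‖ + ε) + K * (‖f‖ + B * (‖g‖ + ε)) := hn.trans (by gcongr)
      have h2 : 0 ≤ K * ‖g‖ + ‖f‖ + K * B * ‖f‖ := by positivity
      linarith
    refine le_of_forall_pos_le_add fun δ hδ => ?_
    have h0 : 0 < 1 + K * B := by positivity
    have := key (δ / (1 + K * B)) (by positivity)
    rwa [mul_div_cancel₀ _ h0.ne'] at this

theorem wellPosed_of_coercive {V : Type*} [NormedAddCommGroup V] [InnerProductSpace ℝ V]
    {V₀ : Submodule ℝ V} [CompleteSpace V₀] {τ : V →ₗ[ℝ] W} (hτ : IsTrace V₀ τ) {b : V →L[ℝ] V →L[ℝ] ℝ}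
    {κ B : ℝ} (hκ : 0 < κ) (hco : ∀ u ∈ V₀, κ * ‖u‖ ^ 2 ≤ b u u) (hB : ‖b‖ ≤ B) :
    WellPosed V₀ τ (1 + κ⁻¹ * (1 + B)) b := by
  have hc : IsCoercive (restrictForm V₀ b) :=
    ⟨κ, hκ, fun u => by
      rw [restrictForm_apply, mul_assoc, ← sq]
      exact hco u u.2⟩
  let e : V₀ ≃L[ℝ] StrongDual ℝ V₀ :=
    hc.continuousLinearEquivOfBilin.trans
      (InnerProductSpace.toDual ℝ V₀).toContinuousLinearEquiv
  have he : ∀ u v : V₀, e u v = b u v := fun u v => by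
    simp only [e, ContinuousLinearEquiv.trans_apply]
    exact hc.continuousLinearEquivOfBilin_apply u v
  refine wellPosed_of_equiv hτ e ?_ (inv_nonneg.2 hκ.le) ?_ hB
  · ext u v
    exact he u v
  · intro f
    set u := e.symm f with hu
    have h1 : κ * ‖u‖ ^ 2 ≤ ‖f‖ * ‖u‖ := by
      calc κ * ‖u‖ ^ 2 ≤ b u u := hco u u.2
        _ = f u := by rw [← he, hu, e.apply_symm_apply]
        _ ≤ ‖f‖ * ‖u‖ := (le_abs_self _).trans (f.le_opNorm u)
    rw [le_inv_mul_iff₀ hκ]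
    rcases (norm_nonneg u).eq_or_lt with h0 | h0
    · rw [← h0]; simp
    · nlinarith

theorem exists_equiv_of_wellPosed [CompleteSpace V₀] (hτ : IsTrace V₀ τ)
    {b : V →L[ℝ] V →L[ℝ] ℝ} {M : ℝ} (h : WellPosed V₀ τ M b) :
    ∃ e : V₀ ≃L[ℝ] StrongDual ℝ V₀, (e : V₀ →L[ℝ] StrongDual ℝ V₀) = restrictForm V₀ b := by
  refine ⟨ContinuousLinearEquiv.ofBijective (restrictForm V₀ b) ?_ ?_, rfl⟩
  · rw [LinearMap.ker_eq_bot']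
    intro u hu
    have h1 : IsSolution V₀ τ b 0 0 (u : V) := by
      refine ⟨(hτ.ker _).2 u.2, fun v => ?_⟩
      have := DFunLike.congr_fun (show restrictForm V₀ b u = 0 from hu) v
      rw [restrictForm_apply] at this
      rw [this]
      simp
    have h2 := (h 0 0).2 _ h1
    simp only [norm_zero, add_zero, mul_zero] at h2
    have h3 : ‖u‖ ≤ 0 := h2
    exact norm_le_zero_iff.1 h3
  · rw [LinearMap.range_eq_top]
    intro f
    obtain ⟨u, hu, -⟩ := (h (-f) 0).1
    refine ⟨⟨u, (hτ.ker _).1 hu.1⟩, ?_⟩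
    ext v
    change b u v = f v
    rw [hu.2 v]
    simp

theorem isOpen_wellPosed [CompleteSpace V₀] (hτ : IsTrace V₀ τ) :
    IsOpen {b : V →L[ℝ] V →L[ℝ] ℝ | ∃ M, WellPosed V₀ τ M b} := by
  have : {b : V →L[ℝ] V →L[ℝ] ℝ | ∃ M, WellPosed V₀ τ M b} = restrictForm V₀ ⁻¹'
      Set.range ((↑) : (V₀ ≃L[ℝ] StrongDual ℝ V₀) → V₀ →L[ℝ] StrongDual ℝ V₀) := by
    ext b
    constructor
    · rintro ⟨M, hM⟩
      exact exists_equiv_of_wellPosed hτ hM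
    · rintro ⟨e, he⟩
      exact ⟨_, wellPosed_of_equiv hτ e he (norm_nonneg _)
        (fun f => (e.symm : StrongDual ℝ V₀ →L[ℝ] V₀).le_opNorm f) le_rfl⟩
  rw [this]
  exact (ContinuousLinearEquiv.isOpen).preimage (restrictForm V₀).continuous

theorem WellPosed.mono {b : V →L[ℝ] V →L[ℝ] ℝ} {M M' : ℝ} (h : WellPosed V₀ τ M b)
    (hM : M ≤ M') : WellPosed V₀ τ M' b := fun f g =>
  ⟨(h f g).1, fun u hu => ((h f g).2 u hu).trans (by gcongr)⟩

/-- `S` maps boundary values to the solutions of the homogeneous equation. -/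
def IsSolutionOp (V₀ : Submodule ℝ V) (τ : V →ₗ[ℝ] W) (b : V →L[ℝ] V →L[ℝ] ℝ)
    (S : W →L[ℝ] V) : Prop := ∀ g, IsSolution V₀ τ b 0 g (S g)

theorem WellPosed.exists_solutionOp {b : V →L[ℝ] V →L[ℝ] ℝ} {M : ℝ} (h : WellPosed V₀ τ M b) :
    ∃ S : W →L[ℝ] V, IsSolutionOp V₀ τ b S ∧ ∀ g, ‖S g‖ ≤ M * ‖g‖ := by
  choose s hs hs' using fun g => (h 0 g).1
  refine ⟨LinearMap.mkContinuous
    { toFun := s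
      map_add' := fun g g' => ?_
      map_smul' := fun c g => ?_ } M fun g => ?_, hs, fun g => ?_⟩
  · refine (hs' _ _ ⟨?_, fun v => ?_⟩).symm
    · rw [map_add, (hs g).1, (hs g').1]
    · rw [map_add, add_apply, (hs g).2, (hs g').2]; simp
  · refine (hs' _ _ ⟨?_, fun v => ?_⟩).symm
    · rw [map_smul, (hs g).1]; rfl
    · rw [map_smul, smul_apply, (hs g).2]; simp
  · simpa using (h 0 g).2 _ (hs g)
  · simpa using (h 0 g).2 _ (hs g)

theorem IsSolutionOp.eq {b : V →L[ℝ] V →L[ℝ] ℝ} {M : ℝ} (h : WellPosed V₀ τ M b)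
    {S : W →L[ℝ] V} (hS : IsSolutionOp V₀ τ b S) {g : W} {u : V}
    (hu : IsSolution V₀ τ b 0 g u) : u = S g :=
  (h 0 g).1.unique hu (hS g)

theorem norm_solutionOp_sub_le {b b' : V →L[ℝ] V →L[ℝ] ℝ} {M : ℝ} (hM : 0 ≤ M)
    (h : WellPosed V₀ τ M b) {S S' : W →L[ℝ] V} (hS : IsSolutionOp V₀ τ b S)
    (hS' : IsSolutionOp V₀ τ b' S') (g : W) :
    ‖S' g - S g‖ ≤ M * ‖b' - b‖ * ‖S' g‖ := by
  have hsol : IsSolution V₀ τ b (((b' - b) (S' g)).comp V₀.subtypeL) 0 (S' g - S g) := by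
    refine ⟨by rw [map_sub, (hS' g).1, (hS g).1, sub_self], fun v => ?_⟩
    have h1 : b (S g) v = 0 := by simpa using (hS g).2 v
    have h2 : b' (S' g) v = 0 := by simpa using (hS' g).2 v
    rw [map_sub, sub_apply, h1]
    simp [h2]
  refine ((h _ _).2 _ hsol).trans ?_
  rw [norm_zero, zero_add, mul_assoc]
  gcongr
  refine ContinuousLinearMap.opNorm_le_bound _ (by positivity) fun v => ?_
  exact (b' - b).le_opNorm₂ (S' g) v

/-- `(ψ, φ) ↦ b(S ψ, S φ)` on a space `Z` of boundary values. -/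
noncomputable def pullback (Z : Submodule ℝ W) (b : V →L[ℝ] V →L[ℝ] ℝ) (S : W →L[ℝ] V) :
    Z →L[ℝ] StrongDual ℝ Z :=
  b.bilinearComp (S.comp Z.subtypeL) (S.comp Z.subtypeL)

@[simp] theorem pullback_apply (Z : Submodule ℝ W) (b : V →L[ℝ] V →L[ℝ] ℝ) (S : W →L[ℝ] V)
    (ψ φ : Z) : pullback Z b S ψ φ = b (S ψ) (S φ) := rfl

theorem form_solution_congr (hτ : IsTrace V₀ τ) {b : V →L[ℝ] V →L[ℝ] ℝ} {g : W} {u v v' : V}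
    (hu : IsSolution V₀ τ b 0 g u) (hv : τ v = τ v') : b u v = b u v' := by
  have h1 : v - v' ∈ V₀ := (hτ.ker _).1 (by rw [map_sub, hv, sub_self])
  have h2 := hu.2 ⟨v - v', h1⟩
  simp only [map_sub, zero_apply, neg_zero] at h2
  linarith

/-- The identity of Alessandrini. -/
theorem pullback_sub_pullback (hτ : IsTrace V₀ τ) (Z : Submodule ℝ W)
    {b b' : V →L[ℝ] V →L[ℝ] ℝ} (hb : ∀ u v, b u v = b v u) {S S' : W →L[ℝ] V}
    (hS : IsSolutionOp V₀ τ b S) (hS' : IsSolutionOp V₀ τ b' S') (ψ φ : Z) :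
    pullback Z b' S' ψ φ - pullback Z b S ψ φ = (b' - b) (S' ψ) (S φ) := by
  have h1 : b' (S' ψ) (S' φ) = b' (S' ψ) (S φ) :=
    form_solution_congr hτ (hS' ψ) (by rw [(hS' φ).1, (hS φ).1])
  have h2 : b (S ψ) (S φ) = b (S' ψ) (S φ) := by
    rw [hb (S ψ), hb (S' ψ)]
    exact form_solution_congr hτ (hS φ) (by rw [(hS' ψ).1, (hS ψ).1])
  rw [pullback_apply, pullback_apply, h1, h2]
  simp

/-- The pull-back of the forms `a H` by `S`, linear in the parameter `H`. -/
noncomputable def pullbackParam (Z : Submodule ℝ W) (a : P →L[ℝ] V →L[ℝ] V →L[ℝ] ℝ)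
    (S : W →L[ℝ] V) : P →L[ℝ] Z →L[ℝ] StrongDual ℝ Z :=
  LinearMap.mkContinuous
    { toFun := fun H => pullback Z (a H) S
      map_add' := fun H H' => by ext; simp
      map_smul' := fun c H => by ext; simp } (‖a‖ * ‖S‖ * ‖S‖) (by
    intro H
    refine ContinuousLinearMap.opNorm_le_bound₂ _ (by positivity) fun ψ φ => ?_
    change ‖a H (S ψ) (S φ)‖ ≤ _
    calc ‖a H (S ψ) (S φ)‖ ≤ ‖a H‖ * ‖S ψ‖ * ‖S φ‖ := (a H).le_opNorm₂ _ _
      _ ≤ (‖a‖ * ‖H‖) * (‖S‖ * ‖(ψ : W)‖) * (‖S‖ * ‖(φ : W)‖) := by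
          gcongr
          exacts [a.le_opNorm H, S.le_opNorm ψ, S.le_opNorm φ]
      _ = ‖a‖ * ‖S‖ * ‖S‖ * ‖H‖ * ‖ψ‖ * ‖φ‖ := by
          rw [Submodule.coe_norm, Submodule.coe_norm]; ring)

@[simp] theorem pullbackParam_apply (Z : Submodule ℝ W) (a : P →L[ℝ] V →L[ℝ] V →L[ℝ] ℝ)
    (S : W →L[ℝ] V) (H : P) (ψ φ : Z) :
    pullbackParam Z a S H ψ φ = a H (S ψ) (S φ) := rfl

theorem norm_pullbackParam_sub_le (Z : Submodule ℝ W) {a : P →L[ℝ] V →L[ℝ] V →L[ℝ] ℝ}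
    {p q : P} {B M : ℝ} (hB : ‖a‖ ≤ B) (hM : 0 ≤ M)
    (hp : WellPosed V₀ τ M (a p)) {S S' : W →L[ℝ] V}
    (hS : IsSolutionOp V₀ τ (a p) S) (hS' : IsSolutionOp V₀ τ (a q) S')
    (hSM : ∀ g, ‖S g‖ ≤ M * ‖g‖) (hSM' : ∀ g, ‖S' g‖ ≤ M * ‖g‖) :
    ‖pullbackParam Z a S' - pullbackParam Z a S‖ ≤ 2 * B ^ 2 * M ^ 3 * ‖q - p‖ := by
  have hB0 : 0 ≤ B := (norm_nonneg _).trans hB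
  have haH : ∀ H : P, ‖a H‖ ≤ B * ‖H‖ := fun H => (a.le_opNorm H).trans (by gcongr)
  have hd : ∀ g, ‖S' g - S g‖ ≤ M * (B * ‖q - p‖) * (M * ‖g‖) := fun g => by
    refine (norm_solutionOp_sub_le hM hp hS hS' g).trans ?_
    gcongr
    · rw [← map_sub]; exact haH _
    · exact hSM' g
  refine ContinuousLinearMap.opNorm_le_bound _ (by positivity) fun H => ?_
  refine ContinuousLinearMap.opNorm_le_bound₂ _ (by positivity) fun ψ φ => ?_
  have h1 : (pullbackParam Z a S' - pullbackParam Z a S) H ψ φ =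
      a H (S' ψ - S ψ) (S' φ) + a H (S ψ) (S' φ - S φ) := by
    simp
  rw [h1]
  calc ‖a H (S' ψ - S ψ) (S' φ) + a H (S ψ) (S' φ - S φ)‖
      ≤ ‖a H‖ * ‖S' ψ - S ψ‖ * ‖S' φ‖ + ‖a H‖ * ‖S ψ‖ * ‖S' φ - S φ‖ :=
        (norm_add_le _ _).trans (add_le_add ((a H).le_opNorm₂ _ _) ((a H).le_opNorm₂ _ _))
    _ ≤ (B * ‖H‖) * (M * (B * ‖q - p‖) * (M * ‖(ψ : W)‖)) * (M * ‖(φ : W)‖) +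
        (B * ‖H‖) * (M * ‖(ψ : W)‖) * (M * (B * ‖q - p‖) * (M * ‖(φ : W)‖)) := by
        gcongr
        exacts [haH H, hd ψ, hSM' φ, haH H, hSM ψ, hd φ]
    _ = 2 * B ^ 2 * M ^ 3 * ‖q - p‖ * ‖H‖ * ‖ψ‖ * ‖φ‖ := by
        rw [Submodule.coe_norm, Submodule.coe_norm]; ring

theorem hasFDerivAt_pullback (hτ : IsTrace V₀ τ) (Z : Submodule ℝ W)
    {a : P →L[ℝ] V →L[ℝ] V →L[ℝ] ℝ} (ha : ∀ p u v, a p u v = a p v u)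
    {F : P → Z →L[ℝ] StrongDual ℝ Z} {p : P} {M : ℝ} (hM : 0 ≤ M)
    (hp : WellPosed V₀ τ M (a p)) {S : W →L[ℝ] V} (hS : IsSolutionOp V₀ τ (a p) S)
    (hF : ∀ᶠ q in 𝓝 p, ∃ S' : W →L[ℝ] V, IsSolutionOp V₀ τ (a q) S' ∧ F q = pullback Z (a q) S') :
    HasFDerivAt F (pullbackParam Z a S) p := by
  have hFp : F p = pullback Z (a p) S := by
    obtain ⟨S', hS', h⟩ := hF.self_of_nhds
    have : S' = S := by
      ext g
      exact IsSolutionOp.eq hp hS (hS' g)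
    rw [h, this]
  rw [hasFDerivAt_iff_isLittleO]
  have hsmall : ∀ᶠ q in 𝓝 p, M * (‖a‖ * ‖q - p‖) ≤ 1 / 2 := by
    have : Tendsto (fun q => M * (‖a‖ * ‖q - p‖)) (𝓝 p) (𝓝 (M * (‖a‖ * ‖p - p‖))) := by
      apply Continuous.tendsto
      fun_prop
    rw [sub_self, norm_zero, mul_zero, mul_zero] at this
    exact (this.eventually_lt_const (by norm_num)).mono fun _ h => h.le
  have hO : (fun q => F q - F p - pullbackParam Z a S (q - p)) =O[𝓝 p]
      fun q => ‖q - p‖ ^ 2 := by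
    refine Asymptotics.IsBigO.of_bound (2 * ‖a‖ ^ 2 * M * ‖S‖ ^ 2) ?_
    filter_upwards [hF, hsmall] with q ⟨S', hS', hq⟩ hs
    have haH : ∀ H : P, ‖a H‖ ≤ ‖a‖ * ‖H‖ := fun H => a.le_opNorm H
    have hd0 : ∀ g, ‖S' g - S g‖ ≤ M * (‖a‖ * ‖q - p‖) * ‖S' g‖ := fun g => by
      refine (norm_solutionOp_sub_le hM hp hS hS' g).trans ?_
      gcongr
      rw [← map_sub]; exact haH _
    have hS'n : ∀ g, ‖S' g‖ ≤ 2 * ‖S g‖ := fun g => by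
      have h1 : ‖S' g‖ ≤ ‖S' g - S g‖ + ‖S g‖ := by
        simpa using norm_add_le (S' g - S g) (S g)
      have h2 := hd0 g
      nlinarith [norm_nonneg (S' g)]
    have hd : ∀ g, ‖S' g - S g‖ ≤ M * (‖a‖ * ‖q - p‖) * (2 * (‖S‖ * ‖g‖)) := fun g => by
      refine (hd0 g).trans ?_
      gcongr
      refine (hS'n g).trans ?_
      gcongr
      exact S.le_opNorm g
    rw [norm_pow, norm_norm]
    refine ContinuousLinearMap.opNorm_le_bound₂ _ (by positivity) fun ψ φ => ?_
    have h1 : (F q - F p - pullbackParam Z a S (q - p)) ψ φ =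
        a (q - p) (S' ψ - S ψ) (S φ) := by
      have := pullback_sub_pullback hτ Z (ha p) hS hS' ψ φ
      rw [hq, hFp]
      simp only [sub_apply, pullbackParam_apply, this, map_sub]
    rw [h1]
    calc ‖a (q - p) (S' ψ - S ψ) (S φ)‖ ≤ ‖a (q - p)‖ * ‖S' ψ - S ψ‖ * ‖S φ‖ :=
          (a (q - p)).le_opNorm₂ _ _
      _ ≤ (‖a‖ * ‖q - p‖) * (M * (‖a‖ * ‖q - p‖) * (2 * (‖S‖ * ‖(ψ : W)‖))) *
          (‖S‖ * ‖(φ : W)‖) := by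
          gcongr
          exacts [haH _, hd ψ, S.le_opNorm φ]
      _ = 2 * ‖a‖ ^ 2 * M * ‖S‖ ^ 2 * ‖q - p‖ ^ 2 * ‖ψ‖ * ‖φ‖ := by
          rw [Submodule.coe_norm, Submodule.coe_norm]; ring
  refine hO.trans_isLittleO ?_
  have h0 : Tendsto (fun q => q - p) (𝓝 p) (𝓝 0) := by
    have : Tendsto (fun q => q - p) (𝓝 p) (𝓝 (p - p)) := by
      apply Continuous.tendsto
      fun_prop
    rwa [sub_self] at this
  exact (Asymptotics.isLittleO_norm_pow_id one_lt_two).comp_tendsto h0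

end

end Variational

/-! ### The elastic form as a bounded trilinear map -/

namespace Elastic

/-- The pointwise energy density of the elastic form. -/
noncomputable def density (ω l m r : ℝ) (G H : Grad) (U V : E3) : ℝ :=
  l * (∑ i, G (i, i)) * (∑ i, H (i, i)) +
    2 * m * (∑ i, ∑ j, ((G (i, j) + G (j, i)) / 2) * ((H (i, j) + H (j, i)) / 2)) -
    r * ω ^ 2 * inner ℝ U V

theorem contract_stiffness {Ω : Set E3} (l m : ℝ) (u v : H1 Ω) (x : E3) :
    contract (stiffness l m (strain u x)) (strain v x) =
      density 0 l m 0 ((u : L2Pair Ω).snd x) ((v : L2Pair Ω).snd x) 0 0 := by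
  simp only [contract, stiffness, strain, grad, density, Fin.sum_univ_three, Matrix.trace,
    Matrix.diag, Matrix.add_apply, Matrix.smul_apply, Matrix.transpose_apply, Matrix.of_apply,
    Matrix.one_apply, smul_eq_mul, Fin.isValue]
  simp
  ring

theorem form_eq_integral_density {N : ℕ} {Ω : Set E3} (D : Fin N → Set E3) (ω : ℝ) (p : Params N)
    (u v : H1 Ω) :
    form D ω p u v = ∫ x in Ω, density ω (piecewiseConst D p.1 x) (piecewiseConst D p.2.1 x)
      (piecewiseConst D p.2.2 x) ((u : L2Pair Ω).snd x) ((v : L2Pair Ω).snd x)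
      ((u : L2Pair Ω).fst x) ((v : L2Pair Ω).fst x) := by
  unfold form
  congr 1
  ext x
  rw [contract_stiffness]
  simp [density, field]

theorem abs_trace_le (G : Grad) : |∑ i : Fin 3, G (i, i)| ≤ 3 * ‖G‖ := by
  calc |∑ i : Fin 3, G (i, i)| ≤ ∑ i : Fin 3, |G (i, i)| := Finset.abs_sum_le_sum_abs _ _
    _ ≤ ∑ _i : Fin 3, ‖G‖ := Finset.sum_le_sum fun i _ => PiLp.norm_apply_le G (i, i)
    _ = 3 * ‖G‖ := by simp

theorem abs_strain_entry_le (G : Grad) (i j : Fin 3) : |(G (i, j) + G (j, i)) / 2| ≤ ‖G‖ := by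
  have h1 : |G (i, j)| ≤ ‖G‖ := PiLp.norm_apply_le G (i, j)
  have h2 : |G (j, i)| ≤ ‖G‖ := PiLp.norm_apply_le G (j, i)
  rw [abs_le] at *
  constructor <;> linarith [h1.1, h1.2, h2.1, h2.2]

theorem abs_density_le {ω l m r c : ℝ} (hl : |l| ≤ c) (hm : |m| ≤ c) (hr : |r| ≤ c) (G H : Grad)
    (U V : E3) :
    |density ω l m r G H U V| ≤ c * (27 * (‖G‖ * ‖H‖) + ω ^ 2 * (‖U‖ * ‖V‖)) := by
  have hc : 0 ≤ c := (abs_nonneg _).trans hl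
  have h1 : |l * (∑ i, G (i, i)) * (∑ i, H (i, i))| ≤ c * (3 * ‖G‖) * (3 * ‖H‖) := by
    rw [abs_mul, abs_mul]
    gcongr
    exacts [abs_trace_le G, abs_trace_le H]
  have h2 : |2 * m * (∑ i : Fin 3, ∑ j : Fin 3,
      ((G (i, j) + G (j, i)) / 2) * ((H (i, j) + H (j, i)) / 2))| ≤ 2 * c * (9 * (‖G‖ * ‖H‖)) := by
    rw [abs_mul, abs_mul, abs_of_pos (two_pos : (0 : ℝ) < 2)]
    gcongr
    calc _ ≤ ∑ i : Fin 3, ∑ j : Fin 3, ‖G‖ * ‖H‖ := by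
          refine (Finset.abs_sum_le_sum_abs _ _).trans (Finset.sum_le_sum fun i _ => ?_)
          refine (Finset.abs_sum_le_sum_abs _ _).trans (Finset.sum_le_sum fun j _ => ?_)
          rw [abs_mul]
          gcongr
          exacts [abs_strain_entry_le G i j, abs_strain_entry_le H i j]
      _ = 9 * (‖G‖ * ‖H‖) := by simp; ring
  have h3 : |r * ω ^ 2 * inner ℝ U V| ≤ c * ω ^ 2 * (‖U‖ * ‖V‖) := by
    rw [abs_mul, abs_mul, abs_of_nonneg (sq_nonneg ω)]
    gcongr
    exact abs_real_inner_le_norm U V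
  unfold density
  refine (abs_sub _ _).trans ?_
  refine (add_le_add ((abs_add_le _ _).trans (add_le_add h1 h2)) h3).trans (le_of_eq ?_)
  ring

theorem piecewiseConst_eq_of_mem {N : ℕ} {D : Fin N → Set E3}
    (hD : ∀ j k, j ≠ k → Disjoint (D j) (D k)) (c : Fin N → ℝ) {j : Fin N} {x : E3}
    (hx : x ∈ D j) : piecewiseConst D c x = c j := by
  unfold piecewiseConst
  rw [Finset.sum_eq_single j, indicator_of_mem hx]
  · intro k _ hk
    exact indicator_of_notMem (fun h => (hD k j hk).le_bot ⟨h, hx⟩) _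
  · simp

theorem abs_piecewiseConst_le {N : ℕ} {D : Fin N → Set E3}
    (hD : ∀ j k, j ≠ k → Disjoint (D j) (D k)) (c : Fin N → ℝ) (x : E3) :
    |piecewiseConst D c x| ≤ ‖c‖ := by
  by_cases h : ∃ j, x ∈ D j
  · obtain ⟨j, hj⟩ := h
    rw [piecewiseConst_eq_of_mem hD c hj]
    exact norm_le_pi_norm c j
  · have : piecewiseConst D c x = 0 :=
      Finset.sum_eq_zero fun j _ => indicator_of_notMem (fun hj => h ⟨j, hj⟩) _
    rw [this, abs_zero]
    exact norm_nonneg _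

theorem measurable_piecewiseConst {N : ℕ} {D : Fin N → Set E3} (hD : ∀ j, IsOpen (D j))
    (c : Fin N → ℝ) : Measurable (piecewiseConst D c) := by
  unfold piecewiseConst
  exact Finset.measurable_fun_sum _ fun j _ => measurable_const.indicator (hD j).measurableSet

theorem abs_density_piecewiseConst_le {N : ℕ} {D : Fin N → Set E3}
    (hd : ∀ j k, j ≠ k → Disjoint (D j) (D k)) (ω : ℝ) (p : Params N) (x : E3) (G H : Grad)
    (U V : E3) :
    |density ω (piecewiseConst D p.1 x) (piecewiseConst D p.2.1 x) (piecewiseConst D p.2.2 x)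
      G H U V| ≤ ‖p‖ * (27 * (‖G‖ * ‖H‖) + ω ^ 2 * (‖U‖ * ‖V‖)) :=
  abs_density_le ((abs_piecewiseConst_le hd _ x).trans (norm_fst_le p))
      ((abs_piecewiseConst_le hd _ x).trans ((norm_fst_le p.2).trans (norm_snd_le p)))
      ((abs_piecewiseConst_le hd _ x).trans ((norm_snd_le p.2).trans (norm_snd_le p)))
      _ _ _ _

section Integrals

variable {Ω : Set E3}

theorem integrable_norm_mul_norm {E : Type*} [NormedAddCommGroup E]
    (f g : Lp E 2 (volume.restrict Ω)) :
    Integrable (fun x => ‖f x‖ * ‖g x‖) (volume.restrict Ω) :=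
  (Lp.memLp f).norm.integrable_mul (Lp.memLp g).norm

theorem integral_norm_sq {E : Type*} [NormedAddCommGroup E] (f : Lp E 2 (volume.restrict Ω)) :
    ∫ x in Ω, ‖f x‖ ^ 2 = ‖f‖ ^ 2 := by
  have h := (Lp.memLp f).eLpNorm_eq_integral_rpow_norm (by norm_num) (by norm_num)
  rw [Lp.norm_def, h, ENNReal.toReal_ofReal (by positivity)]
  simp only [ENNReal.toReal_ofNat, Real.rpow_ofNat]
  rw [← one_div, ← Real.sqrt_eq_rpow, Real.sq_sqrt (integral_nonneg fun x => sq_nonneg _)]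

theorem integral_norm_mul_norm_le {E : Type*} [NormedAddCommGroup E]
    (f g : Lp E 2 (volume.restrict Ω)) :
    ∫ x in Ω, ‖f x‖ * ‖g x‖ ≤ ‖f‖ * ‖g‖ := by
  have h := integral_mul_le_Lp_mul_Lq_of_nonneg (μ := volume.restrict Ω) (p := 2) (q := 2)
    (f := fun x => ‖f x‖) (g := fun x => ‖g x‖) (by constructor <;> norm_num)
    (ae_of_all _ fun x => norm_nonneg _) (ae_of_all _ fun x => norm_nonneg _)
    (by simpa using (Lp.memLp f).norm) (by simpa using (Lp.memLp g).norm)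
  simp only [Real.rpow_ofNat, integral_norm_sq] at h
  rw [← Real.sqrt_eq_rpow, ← Real.sqrt_eq_rpow, Real.sqrt_sq (norm_nonneg _),
    Real.sqrt_sq (norm_nonneg _)] at h
  exact h

variable {N : ℕ} {D : Fin N → Set E3}

theorem integrable_density (hD : ∀ j, IsOpen (D j)) (hd : ∀ j k, j ≠ k → Disjoint (D j) (D k))
    (ω : ℝ) (p : Params N) (u v : L2Pair Ω) :
    Integrable (fun x => density ω (piecewiseConst D p.1 x) (piecewiseConst D p.2.1 x)
      (piecewiseConst D p.2.2 x) (u.snd x) (v.snd x) (u.fst x) (v.fst x))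
      (volume.restrict Ω) := by
  have hb : Integrable (fun x => ‖p‖ * (27 * (‖u.snd x‖ * ‖v.snd x‖) +
      ω ^ 2 * (‖u.fst x‖ * ‖v.fst x‖))) (volume.restrict Ω) :=
    (((integrable_norm_mul_norm _ _).const_mul _).add
      ((integrable_norm_mul_norm _ _).const_mul _)).const_mul _
  refine hb.mono' ?_ (ae_of_all _ fun x => ?_)
  · have m1 := measurable_piecewiseConst hD p.1
    have m2 := measurable_piecewiseConst hD p.2.1
    have m3 := measurable_piecewiseConst hD p.2.2
    have c : ∀ (w : L2Pair Ω) (i : Fin 3 × Fin 3),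
        AEStronglyMeasurable (fun x => w.snd x i) (volume.restrict Ω) := fun w i =>
      (EuclideanSpace.proj (𝕜 := ℝ) i).continuous.comp_aestronglyMeasurable
        (Lp.aestronglyMeasurable _)
    unfold density
    refine AEStronglyMeasurable.sub (AEStronglyMeasurable.add
      ((m1.aestronglyMeasurable.mul ?_).mul ?_) ((m2.aestronglyMeasurable.const_mul 2).mul ?_))
      ((m3.aestronglyMeasurable.mul_const _).mul
        ((Lp.aestronglyMeasurable _).inner (Lp.aestronglyMeasurable _)))
    · exact Finset.aestronglyMeasurable_fun_sum _ fun i _ => c _ _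
    · exact Finset.aestronglyMeasurable_fun_sum _ fun i _ => c _ _
    · refine Finset.aestronglyMeasurable_fun_sum _ fun i _ =>
        Finset.aestronglyMeasurable_fun_sum _ fun j _ => ?_
      simp only [div_eq_mul_inv]
      exact (((c _ _).add (c _ _)).mul_const _).mul (((c _ _).add (c _ _)).mul_const _)
  · exact abs_density_piecewiseConst_le hd ω p x _ _ _ _

theorem abs_form_le (hd : ∀ j k, j ≠ k → Disjoint (D j) (D k))
    (ω : ℝ) (p : Params N) (u v : H1 Ω) :
    |form D ω p u v| ≤ (27 + ω ^ 2) * ‖p‖ * ‖u‖ * ‖v‖ := by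
  rw [form_eq_integral_density, ← Real.norm_eq_abs]
  have hb : Integrable (fun x => ‖p‖ * (27 * (‖(u : L2Pair Ω).snd x‖ * ‖(v : L2Pair Ω).snd x‖) +
      ω ^ 2 * (‖(u : L2Pair Ω).fst x‖ * ‖(v : L2Pair Ω).fst x‖))) (volume.restrict Ω) :=
    (((integrable_norm_mul_norm _ _).const_mul _).add
      ((integrable_norm_mul_norm _ _).const_mul _)).const_mul _
  refine (norm_integral_le_of_norm_le hb (ae_of_all _ fun x => ?_)).trans ?_
  · exact abs_density_piecewiseConst_le hd ω p x _ _ _ _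
  rw [integral_const_mul, integral_add ((integrable_norm_mul_norm _ _).const_mul _)
      ((integrable_norm_mul_norm _ _).const_mul _), integral_const_mul, integral_const_mul]
  have h1 := integral_norm_mul_norm_le (u : L2Pair Ω).snd (v : L2Pair Ω).snd
  have h2 := integral_norm_mul_norm_le (u : L2Pair Ω).fst (v : L2Pair Ω).fst
  have h3 : ‖(u : L2Pair Ω).snd‖ * ‖(v : L2Pair Ω).snd‖ ≤ ‖u‖ * ‖v‖ := by
    gcongr
    exacts [WithLp.norm_snd_le (x := (u : L2Pair Ω)), WithLp.norm_snd_le (x := (v : L2Pair Ω))]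
  have h4 : ‖(u : L2Pair Ω).fst‖ * ‖(v : L2Pair Ω).fst‖ ≤ ‖u‖ * ‖v‖ := by
    gcongr
    exacts [WithLp.norm_fst_le (x := (u : L2Pair Ω)), WithLp.norm_fst_le (x := (v : L2Pair Ω))]
  calc _ ≤ ‖p‖ * (27 * (‖u‖ * ‖v‖) + ω ^ 2 * (‖u‖ * ‖v‖)) := by
        gcongr
        exacts [h1.trans h3, h2.trans h4]
    _ = _ := by ring

theorem form_symm (ω : ℝ) (p : Params N) (u v : H1 Ω) : form D ω p u v = form D ω p v u := by
  rw [form_eq_integral_density, form_eq_integral_density]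
  congr 1
  ext x
  unfold density
  rw [real_inner_comm]
  simp only [Fin.sum_univ_three]
  ring

theorem form_add_left (hD : ∀ j, IsOpen (D j)) (hd : ∀ j k, j ≠ k → Disjoint (D j) (D k))
    (ω : ℝ) (p : Params N) (u u' v : H1 Ω) :
    form D ω p (u + u') v = form D ω p u v + form D ω p u' v := by
  simp only [form_eq_integral_density]
  rw [← integral_add (integrable_density hD hd ω p _ _) (integrable_density hD hd ω p _ _)]
  refine integral_congr_ae ?_
  filter_upwards [Lp.coeFn_add (u : L2Pair Ω).fst (u' : L2Pair Ω).fst,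
    Lp.coeFn_add (u : L2Pair Ω).snd (u' : L2Pair Ω).snd] with x h1 h2
  rw [Submodule.coe_add, WithLp.add_fst, WithLp.add_snd, h1, h2]
  simp only [density, Pi.add_apply, PiLp.add_apply, inner_add_left, Fin.sum_univ_three]
  ring

theorem form_smul_left (ω : ℝ) (p : Params N) (c : ℝ) (u v : H1 Ω) :
    form D ω p (c • u) v = c * form D ω p u v := by
  simp only [form_eq_integral_density]
  rw [← integral_const_mul]
  refine integral_congr_ae ?_
  filter_upwards [Lp.coeFn_smul c (u : L2Pair Ω).fst,
    Lp.coeFn_smul c (u : L2Pair Ω).snd] with x h1 h2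
  rw [Submodule.coe_smul, WithLp.smul_fst, WithLp.smul_snd, h1, h2]
  simp only [density, Pi.smul_apply, PiLp.smul_apply, real_inner_smul_left, Fin.sum_univ_three,
    smul_eq_mul]
  ring

theorem piecewiseConst_add (c c' : Fin N → ℝ) (x : E3) :
    piecewiseConst D (c + c') x = piecewiseConst D c x + piecewiseConst D c' x := by
  simp only [piecewiseConst, ← Finset.sum_add_distrib]
  refine Finset.sum_congr rfl fun j _ => ?_
  by_cases h : x ∈ D j <;> simp [h]

theorem piecewiseConst_smul (a : ℝ) (c : Fin N → ℝ) (x : E3) :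
    piecewiseConst D (a • c) x = a * piecewiseConst D c x := by
  simp only [piecewiseConst, Finset.mul_sum]
  refine Finset.sum_congr rfl fun j _ => ?_
  by_cases h : x ∈ D j <;> simp [h]

theorem form_add_param (hD : ∀ j, IsOpen (D j)) (hd : ∀ j k, j ≠ k → Disjoint (D j) (D k))
    (ω : ℝ) (p q : Params N) (u v : H1 Ω) :
    form D ω (p + q) u v = form D ω p u v + form D ω q u v := by
  simp only [form_eq_integral_density]
  rw [← integral_add (integrable_density hD hd ω p _ _) (integrable_density hD hd ω q _ _)]
  congr 1
  ext x
  simp only [density, Prod.fst_add, Prod.snd_add, piecewiseConst_add]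
  ring

theorem form_smul_param (ω : ℝ) (c : ℝ) (p : Params N) (u v : H1 Ω) :
    form D ω (c • p) u v = c * form D ω p u v := by
  simp only [form_eq_integral_density]
  rw [← integral_const_mul]
  congr 1
  ext x
  simp only [density, Prod.smul_fst, Prod.smul_snd, piecewiseConst_smul]
  ring

/-- The form as a continuous linear function of the parameters, with values in the bounded
bilinear forms on `H¹`. -/
noncomputable def formCLM (Ω : Set E3) (hD : ∀ j, IsOpen (D j))
    (hd : ∀ j k, j ≠ k → Disjoint (D j) (D k)) (ω : ℝ) :
    Params N →L[ℝ] H1 Ω →L[ℝ] H1 Ω →L[ℝ] ℝ :=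
  LinearMap.mkContinuous
    { toFun := fun p => LinearMap.mkContinuous₂
        (LinearMap.mk₂ ℝ (form D ω p) (form_add_left hD hd ω p) (form_smul_left ω p)
          (fun u v v' => by
            rw [form_symm ω p u, form_add_left hD hd ω p, form_symm ω p v, form_symm ω p v'])
          (fun c u v => by
            rw [form_symm ω p u, form_smul_left ω p, form_symm ω p v]; rfl))
        ((27 + ω ^ 2) * ‖p‖) (abs_form_le hd ω p)
      map_add' := fun p q => by
        ext u v
        exact form_add_param hD hd ω p q u v
      map_smul' := fun c p => by
        ext u v
        exact form_smul_param ω c p u v }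
    (27 + ω ^ 2) fun p => LinearMap.mkContinuous₂_norm_le _ (by positivity) (abs_form_le hd ω p)

theorem formCLM_apply (hD : ∀ j, IsOpen (D j)) (hd : ∀ j k, j ≠ k → Disjoint (D j) (D k)) (ω : ℝ)
    (p : Params N) (u v : H1 Ω) : formCLM Ω hD hd ω p u v = form D ω p u v := rfl

theorem norm_formCLM_le (hD : ∀ j, IsOpen (D j)) (hd : ∀ j k, j ≠ k → Disjoint (D j) (D k))
    (ω : ℝ) : ‖formCLM Ω hD hd ω‖ ≤ 27 + ω ^ 2 :=
  LinearMap.mkContinuous_norm_le _ (by positivity) fun p =>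
    LinearMap.mkContinuous₂_norm_le _ (by positivity) (abs_form_le hd ω p)

/-! ### Completeness of `H¹` -/

theorem continuous_integral_coord_mul {ι : Type} [Fintype ι] {i : ι} {θ : E3 → ℝ}
    (hθ : Continuous θ) (hc : HasCompactSupport θ) :
    Continuous fun u : Lp (EuclideanSpace ℝ ι) 2 (volume.restrict Ω) =>
      ∫ x in Ω, u x i * θ x := by
  classical
  have hm : MemLp (fun x => θ x • EuclideanSpace.single i (1 : ℝ)) 2 (volume.restrict Ω) :=
    (hθ.smul continuous_const).memLp_of_hasCompactSupport hc.smul_right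
  have : (fun u : Lp (EuclideanSpace ℝ ι) 2 (volume.restrict Ω) => ∫ x in Ω, u x i * θ x) =
      fun u => inner ℝ (hm.toLp _) u := by
    ext u
    rw [L2.inner_def]
    refine integral_congr_ae ?_
    filter_upwards [hm.coeFn_toLp] with x hx
    rw [hx, real_inner_smul_left, EuclideanSpace.inner_single_left]
    simp [mul_comm]
  rw [this]
  fun_prop

theorem isClosed_H1 (Ω : Set E3) : IsClosed (H1 Ω : Set (L2Pair Ω)) := by
  have : (H1 Ω : Set (L2Pair Ω)) = ⋂ (θ : E3 → ℝ) (_ : ContDiff ℝ (⊤ : ℕ∞) θ)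
      (_ : HasCompactSupport θ) (_ : tsupport θ ⊆ Ω) (i : Fin 3) (j : Fin 3),
      {w : L2Pair Ω | ∫ x in Ω, w.fst x i * fderiv ℝ θ x (EuclideanSpace.single j 1) =
        - ∫ x in Ω, w.snd x (i, j) * θ x} := by
    ext w
    simp only [mem_iInter, mem_ofPred_eq]
    rfl
  rw [this]
  refine isClosed_iInter fun θ => isClosed_iInter fun hθ => isClosed_iInter fun hc =>
    isClosed_iInter fun _ => isClosed_iInter fun i => isClosed_iInter fun j => ?_
  refine isClosed_eq ?_ (Continuous.neg ?_)
  · exact (continuous_integral_coord_mul (continuous_partial hθ j)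
      (hasCompactSupport_partial hc j)).comp (WithLp.continuous_fst _ _ _)
  · exact (continuous_integral_coord_mul hθ.continuous hc).comp (WithLp.continuous_snd _ _ _)

instance completeSpace_H1 (Ω : Set E3) : CompleteSpace (H1 Ω) :=
  (isClosed_H1 Ω).completeSpace_coe

instance completeSpace_H10 (Ω : Set E3) : CompleteSpace (H10 Ω) :=
  (isClosed_H10 Ω).completeSpace_coe

end Integrals

end Elastic

/-! ### Lipschitz boundaries are null sets -/

namespace Elastic

theorem isOpen_cylinder (r L : ℝ) : IsOpen (cylinder r L) := by
  have h1 : Continuous fun x : E3 => x 0 ^ 2 + x 1 ^ 2 := by fun_prop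
  have h2 : Continuous fun x : E3 => |x 2| := by fun_prop
  exact (isOpen_lt h1 continuous_const).inter (isOpen_lt h2 continuous_const)

theorem proj_mem_ball {L : ℝ} {y : E3} (hy : y ∈ cylinder 1 L) :
    (!₂[y 0, y 1] : EuclideanSpace ℝ (Fin 2)) ∈
      Metric.ball (0 : EuclideanSpace ℝ (Fin 2)) 1 := by
  rw [mem_ball_zero_iff, EuclideanSpace.norm_eq, Real.sqrt_lt' one_pos]
  simpa [Fin.sum_univ_two] using hy.1

/-- In a chart, the boundary of an open set that lies above a Lipschitz graph is that graph. -/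
theorem frontier_chart_eq {D : Set E3} (hD : IsOpen D) {L K : ℝ} {T : E3 ≃ᵃⁱ[ℝ] E3}
    {h : EuclideanSpace ℝ (Fin 2) → ℝ}
    (hK : ∀ y ∈ Metric.ball (0 : EuclideanSpace ℝ (Fin 2)) 1,
      ∀ z ∈ Metric.ball (0 : EuclideanSpace ℝ (Fin 2)) 1, |h y - h z| ≤ K * ‖y - z‖)
    (hT : T '' D ∩ cylinder 1 L = {x | x ∈ cylinder 1 L ∧ h !₂[x 0, x 1] < x 2})
    {x : E3} (hx : x ∈ frontier D) (hxc : T x ∈ cylinder 1 L) :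
    (T x) 2 = h !₂[(T x) 0, (T x) 1] := by
  rw [hD.frontier_eq] at hx
  refine le_antisymm ?_ ?_ <;> by_contra! hlt
  · have : T x ∈ T '' D ∩ cylinder 1 L := hT ▸ ⟨hxc, hlt⟩
    obtain ⟨z, hz, hzx⟩ := this.1
    exact hx.2 (T.injective hzx ▸ hz)
  · have hcont : ContinuousOn h (Metric.ball 0 1) :=
      (LipschitzOnWith.of_dist_le_mul (K := K.toNNReal) fun y hy z hz => by
        rw [Real.dist_eq, dist_eq_norm]
        refine (hK y hy z hz).trans ?_
        gcongr
        exact Real.le_coe_toNNReal K).continuousOn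
    have h1 : ContinuousAt h !₂[(T x) 0, (T x) 1] :=
      hcont.continuousAt (Metric.isOpen_ball.mem_nhds (proj_mem_ball hxc))
    have h2 : Continuous fun z : E3 => (!₂[(T z) 0, (T z) 1] : EuclideanSpace ℝ (Fin 2)) := by
      have := T.continuous
      refine (PiLp.continuous_toLp 2 _).comp (continuous_pi fun i => ?_)
      fin_cases i <;> simp <;> fun_prop
    have h3 : ContinuousAt (fun z : E3 => h !₂[(T z) 0, (T z) 1]) x :=
      ContinuousAt.comp (f := fun z : E3 => (!₂[(T z) 0, (T z) 1] : EuclideanSpace ℝ (Fin 2)))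
        h1 h2.continuousAt
    have h4 : ContinuousAt (fun z : E3 => (T z) 2) x := by
      have := T.continuous
      fun_prop
    have h5 : ∀ᶠ z in 𝓝 x, T z ∈ cylinder 1 L :=
      T.continuous.continuousAt.eventually ((isOpen_cylinder 1 L).mem_nhds hxc)
    obtain ⟨z, hz, hzD⟩ := ((mem_closure_iff_frequently.1 hx.1).and_eventually
      ((h4.eventually_lt h3 hlt).and h5)).exists
    have : T z ∈ T '' D ∩ cylinder 1 L := ⟨mem_image_of_mem T hz, hzD.2⟩
    rw [hT] at this
    exact lt_asymm this.2 hzD.1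

theorem volume_frontier_of_isLipschitzDomain {D : Set E3} (hD : IsOpen D) {L : ℝ} (hL : 0 < L)
    (h : IsLipschitzDomain D 1 L) : volume (frontier D) = 0 := by
  refine measure_null_of_locally_null _ fun P hP => ?_
  obtain ⟨T, hTP, h, m, K, -, -, hK, -, hT⟩ := h P hP
  have hopen : IsOpen (T ⁻¹' cylinder 1 L) := (isOpen_cylinder 1 L).preimage T.continuous
  have hPc : T P ∈ cylinder 1 L := by
    rw [hTP]
    simp [cylinder, hL]
  refine ⟨frontier D ∩ T ⁻¹' cylinder 1 L,
    inter_mem self_mem_nhdsWithin (mem_nhdsWithin_of_mem_nhds (hopen.mem_nhds hPc)), ?_⟩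
  set e : E3 := T.linearIsometryEquiv.symm (EuclideanSpace.single 2 1)
  refine Measure.addHaar_eq_zero_of_disjoint_translates volume
    (fun n : ℕ => (1 / ((n : ℝ) + 1)) • e) ?_ ?_
    (isClosed_frontier.measurableSet.inter hopen.measurableSet)
  · have := (tendsto_one_div_add_atTop_nhds_zero_nat (𝕜 := ℝ)).smul_const e
    exact Metric.isBounded_range_of_tendsto _ this
  · intro n k hnk
    rw [Function.onFun, Set.disjoint_left]
    rintro x hxn hxk
    simp only [singleton_add, image_add_left, mem_preimage] at hxn hxk
    apply hnk
    have hn := frontier_chart_eq hD hK hT hxn.1 hxn.2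
    have hk := frontier_chart_eq hD hK hT hxk.1 hxk.2
    have key : ∀ n : ℕ, T (-((1 / ((n : ℝ) + 1)) • e) + x) =
        T x - (1 / ((n : ℝ) + 1)) • EuclideanSpace.single 2 1 := fun n => by
      have := T.map_vadd x (-((1 / ((n : ℝ) + 1)) • e))
      rw [vadd_eq_add] at this
      rw [this, map_neg, map_smul, LinearIsometryEquiv.apply_symm_apply, vadd_eq_add]
      abel
    rw [key] at hn hk
    simp at hn hk
    have h1 : (n : ℝ) + 1 = k + 1 := inv_injective (by linarith)
    exact_mod_cast add_right_cancel h1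

theorem IsPartition.ae_mem_iUnion {A L : ℝ} (hL : 0 < L) {N : ℕ} {Ω : Set E3} {D : Fin N → Set E3}
    {j₁ : Fin N} {S : Set E3} (h : IsPartition A L Ω D j₁ S) :
    ∀ᵐ x ∂volume.restrict Ω, ∃ j, x ∈ D j := by
  have h0 : ∀ᵐ x ∂(volume : Measure E3), ∀ j, x ∉ frontier (D j) :=
    ae_all_iff.2 fun j => measure_eq_zero_iff_ae_notMem.1
      (volume_frontier_of_isLipschitzDomain (h.isOpen_sub j) hL (h.lipschitz_sub j))
  filter_upwards [ae_restrict_of_ae h0, ae_restrict_mem h.isOpen.measurableSet] with x hx hxΩ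
  have h1 := subset_closure hxΩ
  rw [h.closure_eq, mem_iUnion] at h1
  obtain ⟨j, hj⟩ := h1
  refine ⟨j, by_contra fun hxj => hx j ?_⟩
  rw [(h.isOpen_sub j).frontier_eq]
  exact ⟨hj, hxj⟩

end Elastic

/-! ### Identities and inequalities on `H¹₀` -/

namespace Elastic

variable {Ω : Set E3}

/-- The element `u` of `H¹` is the smooth field `Φ` with compact support in `Ω`. -/
def IsTestField (u : H1 Ω) (Φ : E3 → E3) : Prop :=
  ContDiff ℝ (⊤ : ℕ∞) Φ ∧ HasCompactSupport Φ ∧ tsupport Φ ⊆ Ω ∧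
    (field u : E3 → E3) =ᵐ[volume.restrict Ω] Φ

theorem exists_isTestField_of_mem_span {u : H1 Ω}
    (hu : u ∈ Submodule.span ℝ {u : H1 Ω | ∃ Φ, IsTestField u Φ}) : ∃ Φ, IsTestField u Φ := by
  induction hu using Submodule.span_induction with
  | mem u hu => exact hu
  | zero =>
    refine ⟨0, contDiff_const, HasCompactSupport.zero, ?_, Lp.coeFn_zero E3 2 _⟩
    simp [tsupport]
  | add u v _ _ hu hv =>
    obtain ⟨Φ, h1, h2, h3, h4⟩ := hu
    obtain ⟨Ψ, k1, k2, k3, k4⟩ := hv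
    refine ⟨Φ + Ψ, h1.add k1, h2.add k2,
      (tsupport_add Φ Ψ).trans (union_subset h3 k3), ?_⟩
    exact (Lp.coeFn_add (field u) (field v)).trans (h4.add k4)
  | smul c u _ hu =>
    obtain ⟨Φ, h1, h2, h3, h4⟩ := hu
    refine ⟨c • Φ, contDiff_const.smul h1, h2.smul_left (f := fun _ => c),
      (closure_mono (Function.support_const_smul_subset c Φ)).trans h3, ?_⟩
    exact (Lp.coeFn_smul c (field u)).trans (h4.const_smul c)

theorem H10_induction {p : H1 Ω → Prop} (hc : IsClosed {u | p u})
    (ht : ∀ (u : H1 Ω) (Φ : E3 → E3), IsTestField u Φ → p u) {u : H1 Ω} (hu : u ∈ H10 Ω) : p u := by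
  refine closure_minimal (s := (Submodule.span ℝ {u : H1 Ω | ∃ Φ, IsTestField u Φ} : Set (H1 Ω)))
    (fun v hv => ?_) hc hu
  obtain ⟨Φ, hΦ⟩ := exists_isTestField_of_mem_span hv
  exact ht v Φ hΦ

/-- The partial derivative `∂_j Φ_i`. -/
noncomputable def partialDeriv (Φ : E3 → E3) (i j : Fin 3) (x : E3) : ℝ :=
  fderiv ℝ (fun y => Φ y i) x (EuclideanSpace.single j 1)

theorem contDiff_coord {Φ : E3 → E3} (hΦ : ContDiff ℝ (⊤ : ℕ∞) Φ) (i : Fin 3) :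
    ContDiff ℝ (⊤ : ℕ∞) fun y => Φ y i :=
  (EuclideanSpace.proj (𝕜 := ℝ) i).contDiff.comp hΦ

theorem hasCompactSupport_coord {Φ : E3 → E3} (hΦ : HasCompactSupport Φ) (i : Fin 3) :
    HasCompactSupport fun y => Φ y i :=
  hΦ.comp_left (g := fun v : E3 => v i) rfl

theorem tsupport_coord_subset (Φ : E3 → E3) (i : Fin 3) :
    tsupport (fun y => Φ y i) ⊆ tsupport Φ :=
  tsupport_comp_subset (g := fun v : E3 => v i) rfl Φ

theorem contDiff_partialDeriv {Φ : E3 → E3} (hΦ : ContDiff ℝ (⊤ : ℕ∞) Φ) (i j : Fin 3) :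
    ContDiff ℝ (⊤ : ℕ∞) (partialDeriv Φ i j) :=
  ((contDiff_coord hΦ i).fderiv_right (by simp)).clm_apply contDiff_const

theorem hasCompactSupport_partialDeriv {Φ : E3 → E3} (hΦ : HasCompactSupport Φ) (i j : Fin 3) :
    HasCompactSupport (partialDeriv Φ i j) :=
  hasCompactSupport_partial (hasCompactSupport_coord hΦ i) j

theorem tsupport_partialDeriv_subset (Φ : E3 → E3) (i j : Fin 3) :
    tsupport (partialDeriv Φ i j) ⊆ tsupport Φ :=
  (tsupport_fderiv_apply_subset ℝ _).trans (tsupport_coord_subset Φ i)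

theorem setIntegral_eq_integral_of_tsupport_subset {f θ : E3 → ℝ} (h : tsupport θ ⊆ Ω) :
    ∫ x in Ω, f x * θ x = ∫ x, f x * θ x :=
  setIntegral_eq_integral_of_forall_compl_eq_zero fun x hx => by
    rw [image_eq_zero_of_notMem_tsupport fun hx' => hx (h hx'), mul_zero]

/-- The weak gradient of a smooth field is its gradient. -/
theorem weakGradient_ae_eq (hΩ : IsOpen Ω) {u : H1 Ω} {Φ : E3 → E3} (hu : IsTestField u Φ) :
    ∀ᵐ x ∂volume.restrict Ω, ∀ i j, (u : L2Pair Ω).snd x (i, j) = partialDeriv Φ i j x := by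
  obtain ⟨hΦ, hcΦ, -, hae⟩ := hu
  rw [ae_all_iff]; intro i
  rw [ae_all_iff]; intro j
  have hcont : Continuous (partialDeriv Φ i j) := (contDiff_partialDeriv hΦ i j).continuous
  have hcs := hasCompactSupport_partialDeriv hcΦ i j
  have hmem : MemLp (fun x => (u : L2Pair Ω).snd x (i, j)) 2 (volume.restrict Ω) :=
    (EuclideanSpace.proj (𝕜 := ℝ) (i, j)).comp_memLp' (Lp.memLp _)
  have hloc : LocallyIntegrable (fun x => (u : L2Pair Ω).snd x (i, j) - partialDeriv Φ i j x)
      (volume.restrict Ω) :=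
    (hmem.locallyIntegrable (by norm_num)).sub (hcont.locallyIntegrable)
  have key := hΩ.ae_eq_zero_of_integral_contDiff_smul_eq_zero (μ := volume.restrict Ω)
    (hloc.locallyIntegrableOn Ω) fun θ hθ hcθ hsθ => by
      have h1 := u.2 θ hθ hcθ hsθ i j
      have h2 : ∫ x in Ω, (u : L2Pair Ω).fst x i * fderiv ℝ θ x (EuclideanSpace.single j 1) =
          ∫ x in Ω, Φ x i * fderiv ℝ θ x (EuclideanSpace.single j 1) := by
        refine integral_congr_ae ?_
        filter_upwards [hae] with x hx
        rw [show ((u : L2Pair Ω).fst : E3 → E3) x = Φ x from hx]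
      have h3 : ∫ x in Ω, Φ x i * fderiv ℝ θ x (EuclideanSpace.single j 1) =
          ∫ x, Φ x i * fderiv ℝ θ x (EuclideanSpace.single j 1) :=
        setIntegral_eq_integral_of_tsupport_subset
          ((tsupport_fderiv_apply_subset ℝ _).trans hsθ)
      have c1 := contDiff_coord hΦ i
      have h4 : ∫ x, Φ x i * fderiv ℝ θ x (EuclideanSpace.single j 1) =
          - ∫ x, partialDeriv Φ i j x * θ x := by
        refine integral_mul_fderiv_eq_neg_fderiv_mul_of_integrable ?_ ?_ ?_ ?_ ?_
        · exact (hcont.mul hθ.continuous).integrable_of_hasCompactSupport hcθ.mul_left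
        · exact (c1.continuous.mul (continuous_partial hθ j)).integrable_of_hasCompactSupport
            (hasCompactSupport_partial hcθ j).mul_left
        · exact (c1.continuous.mul hθ.continuous).integrable_of_hasCompactSupport hcθ.mul_left
        · exact fun x _ => (c1.differentiable (by simp)).differentiableAt
        · exact fun x _ => (hθ.differentiable (by simp)).differentiableAt
      rw [← setIntegral_eq_integral_of_tsupport_subset hsθ] at h4
      have i1 : Integrable (fun x => (u : L2Pair Ω).snd x (i, j) * θ x) (volume.restrict Ω) :=
        integrable_coord_mul Ω _ _ hθ.continuous hcθ
      have i2 : Integrable (fun x => partialDeriv Φ i j x * θ x) (volume.restrict Ω) :=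
        ((hcont.mul hθ.continuous).integrable_of_hasCompactSupport hcθ.mul_left).restrict
      have h5 : ∫ x in Ω, θ x • ((u : L2Pair Ω).snd x (i, j) - partialDeriv Φ i j x) =
          (∫ x in Ω, (u : L2Pair Ω).snd x (i, j) * θ x) - ∫ x in Ω, partialDeriv Φ i j x * θ x := by
        rw [← integral_sub i1 i2]
        congr 1
        ext x
        rw [smul_eq_mul]
        ring
      rw [h5]
      linarith [h1.symm.trans (h2.trans (h3.trans h4))]
  filter_upwards [key, ae_restrict_mem hΩ.measurableSet] with x hx hxΩ
  exact sub_eq_zero.1 (hx hxΩ)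

theorem fderiv_partialDeriv_comm {Φ : E3 → E3} (hΦ : ContDiff ℝ (⊤ : ℕ∞) Φ) (k i j : Fin 3)
    (x : E3) :
    fderiv ℝ (partialDeriv Φ k i) x (EuclideanSpace.single j 1) =
      fderiv ℝ (partialDeriv Φ k j) x (EuclideanSpace.single i 1) := by
  have c := contDiff_coord hΦ k
  have hd : DifferentiableAt ℝ (fderiv ℝ fun y => Φ y k) x :=
    ((c.fderiv_right (m := (⊤ : ℕ∞)) (by simp)).differentiable (by simp)).differentiableAt
  have h1 : ∀ i j : Fin 3, fderiv ℝ (partialDeriv Φ k i) x (EuclideanSpace.single j 1) =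
      fderiv ℝ (fderiv ℝ fun y => Φ y k) x (EuclideanSpace.single j 1)
        (EuclideanSpace.single i 1) := fun i j => by
    unfold partialDeriv
    rw [fderiv_clm_apply hd (differentiableAt_const _)]
    simp
  rw [h1, h1]
  exact (c.contDiffAt.isSymmSndFDerivAt (by simp [minSmoothness_of_isRCLikeNormedField]; exact WithTop.coe_le_coe.2 le_top)) _ _

/-- `∫ ∂_j u_i ∂_i Φ_j = ∫ ∂_i u_i ∂_j Φ_j` for test fields `Φ`. -/
theorem integral_weakGradient_mul_partialDeriv (u : H1 Ω) {Φ : E3 → E3}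
    (hΦ : ContDiff ℝ (⊤ : ℕ∞) Φ) (hc : HasCompactSupport Φ) (hs : tsupport Φ ⊆ Ω) (i j : Fin 3) :
    ∫ x in Ω, (u : L2Pair Ω).snd x (i, j) * partialDeriv Φ j i x =
      ∫ x in Ω, (u : L2Pair Ω).snd x (i, i) * partialDeriv Φ j j x := by
  have h1 := u.2 (partialDeriv Φ j i) (contDiff_partialDeriv hΦ j i)
    (hasCompactSupport_partialDeriv hc j i) ((tsupport_partialDeriv_subset Φ j i).trans hs) i j
  have h2 := u.2 (partialDeriv Φ j j) (contDiff_partialDeriv hΦ j j)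
    (hasCompactSupport_partialDeriv hc j j) ((tsupport_partialDeriv_subset Φ j j).trans hs) i i
  simp only [fderiv_partialDeriv_comm hΦ j i j] at h1
  linarith

/-- The energy of `u` for the constant isotropic tensor with moduli `l, m`. -/
noncomputable def constEnergy (l m : ℝ) (u : H1 Ω) : ℝ :=
  ∫ x in Ω, density 0 l m 0 ((u : L2Pair Ω).snd x) ((u : L2Pair Ω).snd x) 0 0

theorem constEnergy_eq_form (l m : ℝ) (u : H1 Ω) :
    constEnergy l m u =
      form (fun _ : Fin 1 => univ) 0 ((fun _ => l), (fun _ => m), fun _ => 0) u u := by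
  rw [form_eq_integral_density, constEnergy]
  simp [piecewiseConst, density]

theorem isOpen_univ_family : ∀ _j : Fin 1, IsOpen (univ : Set E3) := fun _ => isOpen_univ

theorem disjoint_univ_family :
    ∀ j k : Fin 1, j ≠ k → Disjoint (univ : Set E3) (univ : Set E3) :=
  fun _ _ h => absurd (Subsingleton.elim _ _) h

theorem integrable_constDensity (l m : ℝ) (u : H1 Ω) :
    Integrable (fun x => density 0 l m 0 ((u : L2Pair Ω).snd x) ((u : L2Pair Ω).snd x) 0 0)
      (volume.restrict Ω) := by
  have := integrable_density (Ω := Ω) (D := fun _ : Fin 1 => univ) isOpen_univ_family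
    disjoint_univ_family 0 ((fun _ => l), (fun _ => m), fun _ => 0) u u
  simpa [piecewiseConst, density] using this

theorem constEnergy_eq (l m : ℝ) (u : H1 Ω) :
    constEnergy l m u = l * constEnergy 1 0 u + m * constEnergy 0 1 u := by
  unfold constEnergy
  rw [← integral_const_mul, ← integral_const_mul,
    ← integral_add ((integrable_constDensity _ _ u).const_mul _)
      ((integrable_constDensity _ _ u).const_mul _)]
  congr 1
  ext x
  simp only [density]
  ring

theorem constEnergy_smul (l m c : ℝ) (u : H1 Ω) :
    constEnergy l m (c • u) = c ^ 2 * constEnergy l m u := by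
  rw [constEnergy_eq_form, constEnergy_eq_form, form_smul_left, form_symm, form_smul_left]
  ring

theorem constEnergy_trace_nonneg (u : H1 Ω) : 0 ≤ constEnergy 1 0 u :=
  integral_nonneg fun x => by
    simp only [density, Pi.zero_apply]
    nlinarith [mul_self_nonneg (∑ i, (u : L2Pair Ω).snd x (i, i))]

theorem continuous_diag (B : H1 Ω →L[ℝ] H1 Ω →L[ℝ] ℝ) : Continuous fun u => B u u :=
  B.continuous.clm_apply continuous_id

theorem continuous_constEnergy (l m : ℝ) : Continuous (constEnergy (Ω := Ω) l m) := by
  have h := continuous_diag (formCLM Ω (D := fun _ : Fin 1 => univ) isOpen_univ_family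
    disjoint_univ_family 0 ((fun _ => l), (fun _ => m), fun _ => 0))
  exact h.congr fun u => (constEnergy_eq_form l m u).symm

theorem continuous_norm_snd : Continuous fun u : H1 Ω => ‖(u : L2Pair Ω).snd‖ :=
  continuous_norm.comp ((WithLp.continuous_snd _ _ _).comp continuous_subtype_val)

theorem continuous_norm_fst : Continuous fun u : H1 Ω => ‖(u : L2Pair Ω).fst‖ :=
  continuous_norm.comp ((WithLp.continuous_fst _ _ _).comp continuous_subtype_val)

/-- Korn's identity: `2 ∫ |∇̂u|² = ∫ |∇u|² + ∫ (div u)²` on `H¹₀`. -/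
theorem korn_identity (hΩ : IsOpen Ω) {u : H1 Ω} (hu : u ∈ H10 Ω) :
    constEnergy 0 1 u = ‖(u : L2Pair Ω).snd‖ ^ 2 + constEnergy 1 0 u := by
  have hcl : IsClosed {u : H1 Ω |
      constEnergy 0 1 u = ‖(u : L2Pair Ω).snd‖ ^ 2 + constEnergy 1 0 u} :=
    isClosed_eq (continuous_constEnergy 0 1)
      ((continuous_norm_snd.pow 2).add (continuous_constEnergy 1 0))
  refine H10_induction hcl ?_ hu
  intro u Φ hΦ
  have hg := weakGradient_ae_eq hΩ hΦ
  obtain ⟨h1, h2, h3, -⟩ := hΦ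
  have key : ∀ i j, ∫ x in Ω, (u : L2Pair Ω).snd x (i, j) * (u : L2Pair Ω).snd x (j, i) =
      ∫ x in Ω, (u : L2Pair Ω).snd x (i, i) * (u : L2Pair Ω).snd x (j, j) := by
    intro i j
    have := integral_weakGradient_mul_partialDeriv u h1 h2 h3 i j
    calc _ = ∫ x in Ω, (u : L2Pair Ω).snd x (i, j) * partialDeriv Φ j i x := by
          refine integral_congr_ae ?_
          filter_upwards [hg] with x hx
          rw [hx j i]
      _ = _ := this
      _ = _ := by
          refine integral_congr_ae ?_
          filter_upwards [hg] with x hx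
          rw [hx j j]
  have hi : ∀ a b : Fin 3 × Fin 3, Integrable
      (fun x => (u : L2Pair Ω).snd x a * (u : L2Pair Ω).snd x b) (volume.restrict Ω) := fun a b =>
    ((EuclideanSpace.proj (𝕜 := ℝ) a).comp_memLp' (Lp.memLp _)).integrable_mul
      ((EuclideanSpace.proj (𝕜 := ℝ) b).comp_memLp' (Lp.memLp _))
  have hsum : ∫ x in Ω, ∑ i, ∑ j, (u : L2Pair Ω).snd x (i, j) * (u : L2Pair Ω).snd x (j, i) =
      ∫ x in Ω, ∑ i, ∑ j, (u : L2Pair Ω).snd x (i, i) * (u : L2Pair Ω).snd x (j, j) := by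
    have hsplit : ∀ a b : Fin 3 → Fin 3 → Fin 3 × Fin 3,
        ∫ x in Ω, ∑ i, ∑ j, (u : L2Pair Ω).snd x (a i j) * (u : L2Pair Ω).snd x (b i j) =
          ∑ i, ∑ j, ∫ x in Ω, (u : L2Pair Ω).snd x (a i j) * (u : L2Pair Ω).snd x (b i j) := by
      intro a b
      rw [integral_finsetSum _ fun i _ => integrable_finsetSum _ fun j _ => hi (a i j) (b i j)]
      exact Finset.sum_congr rfl fun i _ => integral_finsetSum _ fun j _ => hi (a i j) (b i j)
    rw [hsplit (fun i j => (i, j)) fun i j => (j, i), hsplit (fun i _ => (i, i)) fun _ j => (j, j)]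
    exact Finset.sum_congr rfl fun i _ => Finset.sum_congr rfl fun j _ => key i j
  have hY : constEnergy 1 0 u =
      ∫ x in Ω, ∑ i, ∑ j, (u : L2Pair Ω).snd x (i, i) * (u : L2Pair Ω).snd x (j, j) := by
    unfold constEnergy
    congr 1
    ext x
    simp only [density, Fin.sum_univ_three, inner_zero_left]
    ring
  have hn : Integrable (fun x => ‖(u : L2Pair Ω).snd x‖ ^ 2) (volume.restrict Ω) := by
    simpa only [sq] using integrable_norm_mul_norm (u : L2Pair Ω).snd (u : L2Pair Ω).snd
  rw [hY, ← hsum, ← integral_norm_sq, ← integral_add hn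
    (integrable_finsetSum _ fun i _ => integrable_finsetSum _ fun j _ => hi _ _), constEnergy]
  congr 1
  ext x
  rw [EuclideanSpace.norm_sq_eq, Fintype.sum_prod_type]
  simp only [density, Fin.sum_univ_three, Real.norm_eq_abs, sq_abs]
  ring

theorem norm_fderiv_le_of_partialDeriv {Φ : E3 → E3} (hΦ : ContDiff ℝ (⊤ : ℕ∞) Φ) {x : E3}
    {G : Grad} (hG : ∀ i j, G (i, j) = partialDeriv Φ i j x) : ‖fderiv ℝ Φ x‖ ≤ ‖G‖ := by
  refine ContinuousLinearMap.opNorm_le_bound _ (norm_nonneg _) fun v => ?_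
  have hd : DifferentiableAt ℝ Φ x := (hΦ.differentiable (by simp)).differentiableAt
  have hcoord : ∀ i, fderiv ℝ Φ x v i = ∑ j, G (i, j) * v j := fun i => by
    have h1 : fderiv ℝ (fun y => Φ y i) x = (EuclideanSpace.proj (𝕜 := ℝ) i).comp (fderiv ℝ Φ x) :=
      ((EuclideanSpace.proj (𝕜 := ℝ) i).hasFDerivAt.comp x hd.hasFDerivAt).fderiv
    have h2 : v = ∑ j, v j • EuclideanSpace.single j (1 : ℝ) := by
      ext k
      simp [Fin.sum_univ_three]
      fin_cases k <;> simp
    have h3 : fderiv ℝ Φ x v i = fderiv ℝ (fun y => Φ y i) x v := by rw [h1]; rfl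
    rw [h3]
    conv_lhs => rw [h2]
    rw [map_sum]
    refine Finset.sum_congr rfl fun j _ => ?_
    rw [map_smul, hG, smul_eq_mul, mul_comm]
    rfl
  rw [← sq_le_sq₀ (norm_nonneg _) (by positivity), mul_pow, EuclideanSpace.norm_sq_eq,
    EuclideanSpace.norm_sq_eq G, EuclideanSpace.norm_sq_eq v, Fintype.sum_prod_type, Finset.sum_mul]
  refine Finset.sum_le_sum fun i _ => ?_
  simp only [hcoord, Real.norm_eq_abs, sq_abs]
  exact Finset.sum_mul_sq_le_sq_mul_sq _ _ _

/-- The inequality of Poincaré for smooth fields with support in a bounded set. -/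
theorem exists_eLpNorm_le_eLpNorm_fderiv (hb : Bornology.IsBounded Ω) :
    ∃ C : NNReal, ∀ Φ : E3 → E3, ContDiff ℝ (⊤ : ℕ∞) Φ → tsupport Φ ⊆ Ω →
      eLpNorm Φ 2 volume ≤ C * eLpNorm (fderiv ℝ Φ) 2 (volume.restrict Ω) := by
  refine ⟨eLpNormLESNormFDerivOfLeConst E3 (volume : Measure E3) Ω 2 2, fun Φ h1 h3 => ?_⟩
  have hP := eLpNorm_le_eLpNorm_fderiv (F := E3) (volume : Measure E3) (u := Φ) (s := Ω) (p := 2)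
    (h1.of_le (by exact_mod_cast le_top)) ((subset_tsupport Φ).trans h3) (by norm_num)
    (by simp; norm_num) hb
  rw [eLpNorm_restrict_eq_of_support_subset ((support_fderiv_subset ℝ).trans h3)]
  exact hP

theorem eLpNorm_fst_le_of_isTestField (hΩ : IsOpen Ω) {C : NNReal}
    (hC : ∀ Φ : E3 → E3, ContDiff ℝ (⊤ : ℕ∞) Φ → tsupport Φ ⊆ Ω →
      eLpNorm Φ 2 volume ≤ C * eLpNorm (fderiv ℝ Φ) 2 (volume.restrict Ω))
    {u : H1 Ω} {Φ : E3 → E3} (hΦ : IsTestField u Φ) :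
    eLpNorm (u : L2Pair Ω).fst 2 (volume.restrict Ω) ≤
      C * eLpNorm (u : L2Pair Ω).snd 2 (volume.restrict Ω) := by
  have hg := weakGradient_ae_eq hΩ hΦ
  obtain ⟨h1, h2, h3, h4⟩ := hΦ
  have e2 : eLpNorm (fderiv ℝ Φ) 2 (volume.restrict Ω) ≤
      eLpNorm (u : L2Pair Ω).snd 2 (volume.restrict Ω) := by
    refine eLpNorm_mono_ae ?_
    filter_upwards [hg] with x hx
    exact norm_fderiv_le_of_partialDeriv h1 hx
  have e3 : eLpNorm (u : L2Pair Ω).fst 2 (volume.restrict Ω) ≤ eLpNorm Φ 2 volume := by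
    rw [eLpNorm_congr_ae (show ((u : L2Pair Ω).fst : E3 → E3) =ᵐ[volume.restrict Ω] Φ from h4)]
    exact eLpNorm_mono_measure _ Measure.restrict_le_self
  exact e3.trans ((hC Φ h1 h3).trans (by gcongr))

/-- The inequality of Poincaré on a bounded open set. -/
theorem poincare (hΩ : IsOpen Ω) (hb : Bornology.IsBounded Ω) :
    ∃ C : ℝ, ∀ u ∈ H10 Ω, ‖(u : L2Pair Ω).fst‖ ≤ C * ‖(u : L2Pair Ω).snd‖ := by
  obtain ⟨C, hC⟩ := exists_eLpNorm_le_eLpNorm_fderiv hb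
  refine ⟨C, fun u hu => ?_⟩
  have hcl : IsClosed {u : H1 Ω | ‖(u : L2Pair Ω).fst‖ ≤ C * ‖(u : L2Pair Ω).snd‖} :=
    isClosed_le continuous_norm_fst (continuous_const.mul continuous_norm_snd)
  refine H10_induction hcl ?_ hu
  intro u Φ hΦ
  have e4 := eLpNorm_fst_le_of_isTestField hΩ hC hΦ
  rw [Lp.norm_def, Lp.norm_def]
  have := ENNReal.toReal_mono (ENNReal.mul_ne_top ENNReal.coe_ne_top
    (Lp.eLpNorm_ne_top (u : L2Pair Ω).snd)) e4
  rwa [ENNReal.toReal_mul, ENNReal.coe_toReal] at this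

end Elastic

/-! ### Coercivity of the elastic form -/

namespace Elastic

variable {Ω : Set E3}

theorem norm_sq_eq (u : H1 Ω) :
    ‖u‖ ^ 2 = ‖(u : L2Pair Ω).fst‖ ^ 2 + ‖(u : L2Pair Ω).snd‖ ^ 2 :=
  WithLp.prod_norm_sq_eq_of_L2 (u : L2Pair Ω)

theorem firstEigenvalue_eq (Ω : Set E3) (α₀ β₀ : ℝ) :
    firstEigenvalue Ω α₀ β₀ =
      sInf {r | ∃ u ∈ H10 Ω, ‖field u‖ = 1 ∧ r = constEnergy ((β₀ - 3 * α₀) / 2) α₀ u} := by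
  unfold firstEigenvalue constEnergy
  simp only [contract_stiffness]

theorem constEnergy_on_H10 (hΩ : IsOpen Ω) (l m : ℝ) {u : H1 Ω} (hu : u ∈ H10 Ω) :
    constEnergy l m u = (l + m) * constEnergy 1 0 u + m * ‖(u : L2Pair Ω).snd‖ ^ 2 := by
  rw [constEnergy_eq, korn_identity hΩ hu]
  ring

theorem abs_strain_sq_le (G : Grad) : ∑ i : Fin 3, ∑ j : Fin 3,
    ((G (i, j) + G (j, i)) / 2) * ((G (i, j) + G (j, i)) / 2) ≤ ‖G‖ ^ 2 := by
  rw [EuclideanSpace.norm_sq_eq, Fintype.sum_prod_type]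
  simp only [Fin.sum_univ_three, Real.norm_eq_abs, sq_abs]
  nlinarith [sq_nonneg (G (0, 1) - G (1, 0)), sq_nonneg (G (0, 2) - G (2, 0)),
    sq_nonneg (G (1, 2) - G (2, 1))]

theorem constEnergy_strain_le (u : H1 Ω) :
    constEnergy 0 1 u ≤ 2 * ‖(u : L2Pair Ω).snd‖ ^ 2 := by
  rw [← integral_norm_sq, ← integral_const_mul]
  refine integral_mono (integrable_constDensity 0 1 u) ?_ fun x => ?_
  · simpa only [sq] using
      (integrable_norm_mul_norm (u : L2Pair Ω).snd (u : L2Pair Ω).snd).const_mul 2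
  · have := abs_strain_sq_le ((u : L2Pair Ω).snd x)
    simp only [density, inner_zero_left]
    linarith

/-- `∫ (div u)² ≤ ∫ |∇u|²` on `H¹₀`. -/
theorem constEnergy_trace_le (hΩ : IsOpen Ω) {u : H1 Ω} (hu : u ∈ H10 Ω) :
    constEnergy 1 0 u ≤ ‖(u : L2Pair Ω).snd‖ ^ 2 := by
  have h1 := constEnergy_strain_le u
  rw [korn_identity hΩ hu] at h1
  linarith

theorem half_grad_le_constEnergy (hΩ : IsOpen Ω) {α₀ β₀ : ℝ} (hα : 0 < α₀) (hβ : 0 < β₀)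
    {u : H1 Ω} (hu : u ∈ H10 Ω) :
    α₀ / 2 * ‖(u : L2Pair Ω).snd‖ ^ 2 ≤ constEnergy ((β₀ - 3 * α₀) / 2) α₀ u := by
  rw [constEnergy_on_H10 hΩ _ _ hu]
  have h1 := constEnergy_trace_le hΩ hu
  have h2 := constEnergy_trace_nonneg u
  nlinarith [mul_nonneg hβ.le h2, mul_nonneg hα.le (sub_nonneg.2 h1)]

theorem bddBelow_energies (hΩ : IsOpen Ω) {α₀ β₀ : ℝ} (hα : 0 < α₀) (hβ : 0 < β₀) :
    BddBelow {r | ∃ u ∈ H10 Ω, ‖field u‖ = 1 ∧ r = constEnergy ((β₀ - 3 * α₀) / 2) α₀ u} := by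
  refine ⟨0, ?_⟩
  rintro r ⟨u, hu, -, rfl⟩
  exact le_trans (by positivity) (half_grad_le_constEnergy hΩ hα hβ hu)

theorem normalized_mem (u : H1 Ω) (hu : u ∈ H10 Ω) (h0 : (u : L2Pair Ω).fst ≠ 0) :
    ‖(u : L2Pair Ω).fst‖⁻¹ • u ∈ H10 Ω ∧ ‖field (‖(u : L2Pair Ω).fst‖⁻¹ • u)‖ = 1 := by
  refine ⟨(H10 Ω).smul_mem _ hu, ?_⟩
  have : field (‖(u : L2Pair Ω).fst‖⁻¹ • u) = ‖(u : L2Pair Ω).fst‖⁻¹ • (u : L2Pair Ω).fst := rfl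
  rw [this, norm_smul, norm_inv, norm_norm, inv_mul_cancel₀ (norm_ne_zero_iff.2 h0)]

theorem firstEigenvalue_mul_le (hΩ : IsOpen Ω) {α₀ β₀ : ℝ} (hα : 0 < α₀) (hβ : 0 < β₀)
    {u : H1 Ω} (hu : u ∈ H10 Ω) :
    firstEigenvalue Ω α₀ β₀ * ‖(u : L2Pair Ω).fst‖ ^ 2 ≤
      constEnergy ((β₀ - 3 * α₀) / 2) α₀ u := by
  by_cases h0 : (u : L2Pair Ω).fst = 0
  · rw [h0, norm_zero]
    exact le_trans (by simp; positivity) (half_grad_le_constEnergy hΩ hα hβ hu)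
  · have hn := norm_pos_iff.2 h0
    obtain ⟨h1, h2⟩ := normalized_mem u hu h0
    have h3 := csInf_le (bddBelow_energies hΩ hα hβ) ⟨_, h1, h2, rfl⟩
    rw [← firstEigenvalue_eq, constEnergy_smul, inv_pow] at h3
    rwa [← le_div_iff₀ (by positivity), div_eq_inv_mul]

/-- The smallest eigenvalue is positive, unless `H¹₀` is trivial. -/
theorem firstEigenvalue_pos (hΩ : IsOpen Ω) (hb : Bornology.IsBounded Ω) {α₀ β₀ : ℝ} (hα : 0 < α₀)
    (hβ : 0 < β₀) {u : H1 Ω} (hu : u ∈ H10 Ω) (h0 : (u : L2Pair Ω).fst ≠ 0) :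
    0 < firstEigenvalue Ω α₀ β₀ := by
  obtain ⟨C, hC⟩ := poincare hΩ hb
  obtain ⟨h1, h2⟩ := normalized_mem u hu h0
  have hC0 : 0 < C := by
    by_contra hC0
    have := hC _ h1
    rw [show ‖((‖(u : L2Pair Ω).fst‖⁻¹ • u : H1 Ω) : L2Pair Ω).fst‖ = 1 from h2] at this
    nlinarith [norm_nonneg ((‖(u : L2Pair Ω).fst‖⁻¹ • u : H1 Ω) : L2Pair Ω).snd]
  rw [firstEigenvalue_eq]
  refine lt_of_lt_of_le (show 0 < α₀ / 2 * (C⁻¹) ^ 2 by positivity) (le_csInf ⟨_, _, h1, h2, rfl⟩ ?_)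
  rintro r ⟨v, hv, hv1, rfl⟩
  refine le_trans ?_ (half_grad_le_constEnergy hΩ hα hβ hv)
  have h3 : 1 ≤ C * ‖(v : L2Pair Ω).snd‖ := by
    rw [← hv1]
    exact hC v hv
  gcongr
  rwa [inv_le_iff_one_le_mul₀' hC0]

/-- The constant in the coercivity estimate. -/
noncomputable def coercivityConst (α₀ lam₁ : ℝ) : ℝ :=
  if 0 < lam₁ then min (α₀ / 6) (lam₁ / 12) else α₀ / 6

theorem coercivityConst_pos {α₀ lam₁ : ℝ} (hα : 0 < α₀) : 0 < coercivityConst α₀ lam₁ := by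
  unfold coercivityConst
  split_ifs <;> positivity

theorem coercivityConst_mul_le (hΩ : IsOpen Ω) (hb : Bornology.IsBounded Ω) {α₀ β₀ : ℝ}
    (hα : 0 < α₀) (hβ : 0 < β₀) {u : H1 Ω} (hu : u ∈ H10 Ω) :
    coercivityConst α₀ (firstEigenvalue Ω α₀ β₀) * ‖u‖ ^ 2 ≤
      α₀ / 6 * ‖(u : L2Pair Ω).snd‖ ^ 2 +
        firstEigenvalue Ω α₀ β₀ / 12 * ‖(u : L2Pair Ω).fst‖ ^ 2 := by
  rw [norm_sq_eq, coercivityConst]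
  split_ifs with h
  · have h1 := min_le_left (α₀ / 6) (firstEigenvalue Ω α₀ β₀ / 12)
    have h2 := min_le_right (α₀ / 6) (firstEigenvalue Ω α₀ β₀ / 12)
    rw [mul_add, add_comm]
    gcongr
  · have h0 : (u : L2Pair Ω).fst = 0 := by
      by_contra h0
      exact h (firstEigenvalue_pos hΩ hb hα hβ hu h0)
    simp [h0]

theorem density_lower_bound {s α₀ β₀ l m r R ω : ℝ} (hm : s * α₀ ≤ m)
    (hl : s * β₀ ≤ 2 * m + 3 * l) (hr : r ≤ R) (G : Grad) (U : E3) :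
    s * density 0 ((β₀ - 2 * α₀) / 3) α₀ 0 G G 0 0 - R * ω ^ 2 * ‖U‖ ^ 2 ≤
      density ω l m r G G U U := by
  have h1 : r * ω ^ 2 * ‖U‖ ^ 2 ≤ R * ω ^ 2 * ‖U‖ ^ 2 := by gcongr
  have h2 : (∑ i, G (i, i)) ^ 2 ≤ 3 * ∑ i : Fin 3, ∑ j : Fin 3,
      ((G (i, j) + G (j, i)) / 2) * ((G (i, j) + G (j, i)) / 2) := by
    simp only [Fin.sum_univ_three]
    nlinarith [sq_nonneg (G (0, 0) - G (1, 1)), sq_nonneg (G (0, 0) - G (2, 2)),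
      sq_nonneg (G (1, 1) - G (2, 2)), sq_nonneg (G (0, 1) + G (1, 0)),
      sq_nonneg (G (0, 2) + G (2, 0)), sq_nonneg (G (1, 2) + G (2, 1))]
  simp only [density, real_inner_self_eq_norm_sq, norm_zero]
  set t := ∑ i, G (i, i)
  set e := ∑ i : Fin 3, ∑ j : Fin 3, ((G (i, j) + G (j, i)) / 2) * ((G (i, j) + G (j, i)) / 2)
  nlinarith [mul_nonneg (sub_nonneg.2 hm) (sub_nonneg.2 h2),
    mul_nonneg (sub_nonneg.2 hl) (sq_nonneg t)]

theorem form_lower_bound {N : ℕ} {D : Fin N → Set E3} (hD : ∀ j, IsOpen (D j))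
    (hd : ∀ j k, j ≠ k → Disjoint (D j) (D k)) (hae : ∀ᵐ x ∂volume.restrict Ω, ∃ j, x ∈ D j)
    {s α₀ β₀ R ω : ℝ} {p : Params N} (hm : ∀ j, s * α₀ ≤ p.2.1 j)
    (hl : ∀ j, s * β₀ ≤ 2 * p.2.1 j + 3 * p.1 j) (hr : ∀ j, p.2.2 j ≤ R) (u : H1 Ω) :
    s * constEnergy ((β₀ - 2 * α₀) / 3) α₀ u - R * ω ^ 2 * ‖(u : L2Pair Ω).fst‖ ^ 2 ≤
      form D ω p u u := by
  have hn : Integrable (fun x => ‖(u : L2Pair Ω).fst x‖ ^ 2) (volume.restrict Ω) := by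
    simpa only [sq] using integrable_norm_mul_norm (u : L2Pair Ω).fst (u : L2Pair Ω).fst
  rw [form_eq_integral_density, ← integral_norm_sq, constEnergy, ← integral_const_mul,
    ← integral_const_mul, ← integral_sub ((integrable_constDensity _ _ u).const_mul _)
      (hn.const_mul _)]
  refine integral_mono_ae (((integrable_constDensity _ _ u).const_mul _).sub (hn.const_mul _))
    (integrable_density hD hd ω p _ _) ?_
  filter_upwards [hae] with x ⟨j, hj⟩
  rw [piecewiseConst_eq_of_mem hd _ hj, piecewiseConst_eq_of_mem hd _ hj,
    piecewiseConst_eq_of_mem hd _ hj]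
  exact density_lower_bound (hm j) (hl j) (hr j) _ _

/-- Coercivity of the form on `H¹₀`, for coefficients bounded below by `s` times the a priori
bounds and a frequency below the first eigenfrequency. -/
theorem form_coercive (hΩ : IsOpen Ω) (hb : Bornology.IsBounded Ω) {N : ℕ} {D : Fin N → Set E3}
    (hD : ∀ j, IsOpen (D j)) (hd : ∀ j k, j ≠ k → Disjoint (D j) (D k))
    (hae : ∀ᵐ x ∂volume.restrict Ω, ∃ j, x ∈ D j) {s α₀ β₀ R ω : ℝ} {p : Params N}
    (hs : 1 / 2 ≤ s) (hα : 0 < α₀) (hβ : 0 < β₀) (hm : ∀ j, s * α₀ ≤ p.2.1 j)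
    (hl : ∀ j, s * β₀ ≤ 2 * p.2.1 j + 3 * p.1 j) (hr : ∀ j, p.2.2 j ≤ R)
    (hR : R * ω ^ 2 ≤ s * firstEigenvalue Ω α₀ β₀ / 2) {u : H1 Ω} (hu : u ∈ H10 Ω) :
    coercivityConst α₀ (firstEigenvalue Ω α₀ β₀) * ‖u‖ ^ 2 ≤ form D ω p u u := by
  refine (coercivityConst_mul_le hΩ hb hα hβ hu).trans
    (le_trans ?_ (form_lower_bound hD hd hae hm hl hr u))
  have h1 := firstEigenvalue_mul_le hΩ hα hβ hu
  have h2 := constEnergy_trace_nonneg u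
  have h3 := half_grad_le_constEnergy hΩ hα hβ hu
  rw [constEnergy_on_H10 hΩ _ _ hu] at h1 h3 ⊢
  set X := ‖(u : L2Pair Ω).snd‖ ^ 2 with hX
  set Z := ‖(u : L2Pair Ω).fst‖ ^ 2 with hZ
  set Y := constEnergy 1 0 u
  set lam := firstEigenvalue Ω α₀ β₀
  set E := ((β₀ - 3 * α₀) / 2 + α₀) * Y + α₀ * X with hE
  have hX0 : 0 ≤ X := sq_nonneg _
  have hZ0 : 0 ≤ Z := sq_nonneg _
  have h5 : R * ω ^ 2 * Z ≤ s / 2 * (lam * Z) := by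
    calc R * ω ^ 2 * Z ≤ (s * lam / 2) * Z := by gcongr
      _ = _ := by ring
  have h6 : 2 / 3 * E + α₀ / 3 * X ≤ ((β₀ - 2 * α₀) / 3 + α₀) * Y + α₀ * X := by
    rw [hE]
    nlinarith [mul_nonneg hα.le h2, mul_nonneg hα.le hX0]
  have hs0 : 0 ≤ s := by linarith
  have h7 := mul_le_mul_of_nonneg_left h6 hs0
  have h8 := mul_le_mul_of_nonneg_left h1 hs0
  have h9 : 0 ≤ E := le_trans (by positivity) h3
  nlinarith [mul_nonneg (sub_nonneg.2 hs) h9, mul_nonneg (sub_nonneg.2 hs)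
    (mul_nonneg hα.le hX0)]

end Elastic

/-! ### The forward map -/

namespace Elastic

open Variational

section Forward

variable {Ω S : Set E3} {N : ℕ} {D : Fin N → Set E3}

theorem isTrace_trace (Ω : Set E3) : IsTrace (H10 Ω) (trace (Ω := Ω)) where
  ker _ := Submodule.Quotient.mk_eq_zero _
  lift g _ hε := Submodule.Quotient.norm_mk_lt (S := H10 Ω) g hε

theorem isWeakSolution_iff (hD : ∀ j, IsOpen (D j)) (hd : ∀ j k, j ≠ k → Disjoint (D j) (D k))
    (ω : ℝ) (p : Params N) (f : StrongDual ℝ (H10 Ω)) (g : TraceSpace Ω) (u : H1 Ω) :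
    IsWeakSolution D ω p f g u ↔ IsSolution (H10 Ω) trace (formCLM Ω hD hd ω p) f g u := by
  unfold IsWeakSolution IsSolution
  simp only [formCLM_apply]

theorem wellPosedWith_iff (hD : ∀ j, IsOpen (D j)) (hd : ∀ j k, j ≠ k → Disjoint (D j) (D k))
    (ω M : ℝ) (p : Params N) :
    WellPosedWith Ω D ω M p ↔ WellPosed (H10 Ω) trace M (formCLM Ω hD hd ω p) := by
  unfold WellPosedWith WellPosed
  simp only [isWeakSolution_iff hD hd]

theorem isLocalDNMap_pullback (hD : ∀ j, IsOpen (D j)) (hd : ∀ j k, j ≠ k → Disjoint (D j) (D k))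
    {ω M : ℝ} {p : Params N} (hp : WellPosed (H10 Ω) trace M (formCLM Ω hD hd ω p))
    {Q : TraceSpace Ω →L[ℝ] H1 Ω} (hQ : IsSolutionOp (H10 Ω) trace (formCLM Ω hD hd ω p) Q) :
    IsLocalDNMap D ω S p (pullback (Hco Ω S) (formCLM Ω hD hd ω p) Q) := by
  intro ψ φ u v hu hv
  have h1 : u = Q ψ := IsSolutionOp.eq hp hQ ((isWeakSolution_iff hD hd _ _ _ _ _).1 hu)
  have h2 : form D ω p (Q ψ) (Q φ) = form D ω p (Q ψ) v :=
    form_solution_congr (isTrace_trace Ω) (hQ ψ) ((hQ φ).1.trans hv.symm)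
  exact h2.trans (congrArg (fun w => form D ω p w v) h1.symm)

theorem forwardMap_eq_pullback (hD : ∀ j, IsOpen (D j)) (hd : ∀ j k, j ≠ k → Disjoint (D j) (D k))
    {ω M : ℝ} {p : Params N} (hp : WellPosed (H10 Ω) trace M (formCLM Ω hD hd ω p))
    {Q : TraceSpace Ω →L[ℝ] H1 Ω} (hQ : IsSolutionOp (H10 Ω) trace (formCLM Ω hD hd ω p) Q) :
    forwardMap Ω D ω S p = pullback (Hco Ω S) (formCLM Ω hD hd ω p) Q := by
  have hex : ∃ T, IsLocalDNMap D ω S p T := ⟨_, isLocalDNMap_pullback hD hd hp hQ⟩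
  have h : forwardMap Ω D ω S p = hex.choose := dif_pos hex
  refine h.trans (ContinuousLinearMap.ext fun ψ => ContinuousLinearMap.ext fun φ => ?_)
  exact hex.choose_spec ψ φ (Q ψ) (Q φ) ((isWeakSolution_iff hD hd _ _ _ _ _).2 (hQ ψ)) (hQ φ).1

theorem isOpen_admissible (N : ℕ) (α₀ β₀ γ₀ : ℝ) : IsOpen (admissible N α₀ β₀ γ₀) := by
  have : admissible N α₀ β₀ γ₀ = ⋂ j, {p : Params N | α₀ / 2 < p.2.1 j ∧ p.2.1 j < 2 / α₀ ∧
      p.1 j < 2 / α₀ ∧ β₀ / 2 < 2 * p.2.1 j + 3 * p.1 j ∧ γ₀ / 2 < p.2.2 j ∧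
        p.2.2 j < 2 / γ₀} := by
    ext p
    simp only [mem_iInter]
    rfl
  rw [this]
  refine isOpen_iInter_of_finite fun j => ?_
  simp only [ofPred_and]
  refine (isOpen_lt ?_ ?_).inter ((isOpen_lt ?_ ?_).inter ((isOpen_lt ?_ ?_).inter
    ((isOpen_lt ?_ ?_).inter ((isOpen_lt ?_ ?_).inter (isOpen_lt ?_ ?_))))) <;> fun_prop

theorem norm_le_of_admissible {α₀ β₀ γ₀ : ℝ} (hα : 0 < α₀) (hβ : 0 < β₀) (hγ : 0 < γ₀)
    {p : Params N} (hp : p ∈ admissible N α₀ β₀ γ₀) : ‖p‖ ≤ 2 / α₀ + 2 / γ₀ := by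
  have ha : 0 < 2 / α₀ := by positivity
  have hg : 0 < 2 / γ₀ := by positivity
  refine norm_prod_le_iff.2 ⟨?_, norm_prod_le_iff.2 ⟨?_, ?_⟩⟩ <;>
    refine (pi_norm_le_iff_of_nonneg (by positivity)).2 fun j => ?_ <;>
    rw [Real.norm_eq_abs, abs_le] <;>
    obtain ⟨h1, h2, h3, h4, h5, h6⟩ := hp j <;>
    constructor <;> linarith

theorem regular_eq (hD : ∀ j, IsOpen (D j)) (hd : ∀ j k, j ≠ k → Disjoint (D j) (D k))
    (ω α₀ β₀ γ₀ : ℝ) : regular Ω D ω α₀ β₀ γ₀ = admissible N α₀ β₀ γ₀ ∩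
      formCLM Ω hD hd ω ⁻¹' {b | ∃ M, WellPosed (H10 Ω) trace M b} := by
  ext p
  simp only [regular, regularWith, wellPosedWith_iff hD hd]
  exact exists_and_left

theorem isOpen_regular (hD : ∀ j, IsOpen (D j)) (hd : ∀ j k, j ≠ k → Disjoint (D j) (D k))
    (ω α₀ β₀ γ₀ : ℝ) : IsOpen (regular Ω D ω α₀ β₀ γ₀) := by
  rw [regular_eq hD hd]
  exact (isOpen_admissible N α₀ β₀ γ₀).inter
    ((isOpen_wellPosed (isTrace_trace Ω)).preimage (formCLM Ω hD hd ω).continuous)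

theorem exists_forwardMap_eq_pullback (hD : ∀ j, IsOpen (D j))
    (hd : ∀ j k, j ≠ k → Disjoint (D j) (D k)) {ω α₀ β₀ γ₀ M : ℝ} {p : Params N}
    (hp : p ∈ regularWith Ω D ω α₀ β₀ γ₀ M) :
    ∃ Q : TraceSpace Ω →L[ℝ] H1 Ω, IsSolutionOp (H10 Ω) trace (formCLM Ω hD hd ω p) Q ∧
      forwardMap Ω D ω S p = pullback (Hco Ω S) (formCLM Ω hD hd ω p) Q := by
  have hp' := (wellPosedWith_iff hD hd ω M p).1 hp.2
  exact hp'.exists_solutionOp.imp fun Q hQ => ⟨hQ.1, forwardMap_eq_pullback hD hd hp' hQ.1⟩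

theorem hasFDerivAt_forwardMap (hD : ∀ j, IsOpen (D j))
    (hd : ∀ j k, j ≠ k → Disjoint (D j) (D k)) {ω α₀ β₀ γ₀ M : ℝ} {p : Params N}
    (hp : p ∈ regularWith Ω D ω α₀ β₀ γ₀ M) {Q : TraceSpace Ω →L[ℝ] H1 Ω}
    (hQ : IsSolutionOp (H10 Ω) trace (formCLM Ω hD hd ω p) Q) :
    HasFDerivAt (forwardMap Ω D ω S) (pullbackParam (Hco Ω S) (formCLM Ω hD hd ω) Q) p := by
  have hwp := ((wellPosedWith_iff hD hd ω M p).1 hp.2).mono (le_abs_self M)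
  refine hasFDerivAt_pullback (isTrace_trace Ω) (Hco Ω S)
    (fun q u v => form_symm ω q u v) (abs_nonneg M) hwp hQ ?_
  filter_upwards [(isOpen_regular hD hd ω α₀ β₀ γ₀).mem_nhds ⟨M, hp⟩] with q ⟨M', hq⟩
  exact exists_forwardMap_eq_pullback hD hd hq

theorem lipschitzOnWith_fderiv_forwardMap (hD : ∀ j, IsOpen (D j))
    (hd : ∀ j k, j ≠ k → Disjoint (D j) (D k)) {ω α₀ β₀ γ₀ B : ℝ}
    (hB : ‖formCLM Ω hD hd ω‖ ≤ B) (M : ℝ) :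
    LipschitzOnWith (2 * B ^ 2 * |M| ^ 3).toNNReal (fderiv ℝ (forwardMap Ω D ω S))
      (regularWith Ω D ω α₀ β₀ γ₀ M) := by
  refine LipschitzOnWith.of_dist_le_mul fun q hq p hp => ?_
  have hp' := ((wellPosedWith_iff hD hd ω M p).1 hp.2).mono (le_abs_self M)
  have hq' := ((wellPosedWith_iff hD hd ω M q).1 hq.2).mono (le_abs_self M)
  obtain ⟨Q, hQ, hQM⟩ := hp'.exists_solutionOp
  obtain ⟨Q', hQ', hQM'⟩ := hq'.exists_solutionOp
  rw [(hasFDerivAt_forwardMap hD hd hp hQ).fderiv, (hasFDerivAt_forwardMap hD hd hq hQ').fderiv,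
    dist_eq_norm, dist_eq_norm, Real.coe_toNNReal _ (by positivity)]
  exact norm_pullbackParam_sub_le (Hco Ω S) hB (abs_nonneg M) hp' hQ hQ' hQM hQM'

theorem mem_regularWith_of_lower_bounds (hΩ : IsOpen Ω) (hb : Bornology.IsBounded Ω)
    (hD : ∀ j, IsOpen (D j)) (hd : ∀ j k, j ≠ k → Disjoint (D j) (D k))
    (hae : ∀ᵐ x ∂volume.restrict Ω, ∃ j, x ∈ D j) {s α₀ β₀ γ₀ R ω B : ℝ} {p : Params N}
    (hs : 1 / 2 ≤ s) (hα : 0 < α₀) (hβ : 0 < β₀) (hγ : 0 < γ₀)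
    (hB : ‖formCLM Ω hD hd ω‖ ≤ B) (hp : p ∈ admissible N α₀ β₀ γ₀)
    (hm : ∀ j, s * α₀ ≤ p.2.1 j) (hl : ∀ j, s * β₀ ≤ 2 * p.2.1 j + 3 * p.1 j)
    (hr : ∀ j, p.2.2 j ≤ R) (hR : R * ω ^ 2 ≤ s * firstEigenvalue Ω α₀ β₀ / 2) :
    p ∈ regularWith Ω D ω α₀ β₀ γ₀ (1 + (coercivityConst α₀ (firstEigenvalue Ω α₀ β₀))⁻¹ *
      (1 + B * (2 / α₀ + 2 / γ₀))) := by
  refine ⟨hp, (wellPosedWith_iff hD hd _ _ _).2 ?_⟩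
  refine wellPosed_of_coercive (isTrace_trace Ω) (coercivityConst_pos hα)
    (fun u hu => form_coercive hΩ hb hD hd hae hs hα hβ hm hl hr hR hu) ?_
  refine ((formCLM Ω hD hd ω).le_opNorm p).trans ?_
  have hB0 : 0 ≤ B := le_trans (norm_nonneg (formCLM Ω hD hd ω)) hB
  have := norm_le_of_admissible hα hβ hγ hp
  gcongr

end Forward

end Elastic

open Elastic Variational in
theorem proposition3p1 (A L α₀ β₀ γ₀ lam₁ : ℝ) (hA : 0 < A) (hL : 1 < L)
    (hα : 0 < α₀ ∧ α₀ < 1) (hβ : 0 < β₀ ∧ β₀ < 2) (hγ : 0 < γ₀ ∧ γ₀ < 1) :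
    ∃ (M₀ : ℝ) (C : ℝ → NNReal),
      ∀ (N : ℕ) (Ω : Set Elastic.E3) (D : Fin N → Set Elastic.E3) (j₁ : Fin N)
        (S : Set Elastic.E3) (ω : ℝ),
        Elastic.IsPartition A L Ω D j₁ S →
        Elastic.firstEigenvalue Ω α₀ β₀ = lam₁ →
        ω ^ 2 ≤ γ₀ * lam₁ / 2 →
        -- the set on which the forward map is defined is open, and `F` is differentiable there
        IsOpen (Elastic.regular Ω D ω α₀ β₀ γ₀) ∧
        (∀ p ∈ Elastic.regular Ω D ω α₀ β₀ γ₀,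
          Elastic.IsLocalDNMap D ω S p (Elastic.forwardMap Ω D ω S p) ∧
          ∃ DF : Elastic.Params N →L[ℝ] Elastic.Hco Ω S →L[ℝ] Elastic.HcoDual Ω S,
            HasFDerivAt (Elastic.forwardMap Ω D ω S) DF p ∧
            ∀ (H : Elastic.Params N) (ψ φ : Elastic.Hco Ω S) (u v : Elastic.H1 Ω),
              Elastic.IsWeakSolution D ω p 0 ψ u → Elastic.IsWeakSolution D ω p 0 φ v →
              DF H ψ φ = Elastic.form D ω H u v) ∧
        -- that set contains the a priori set, and all of `𝒜` under the bound on `ω` adapted to `𝒜`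
        Elastic.aprioriSet N α₀ β₀ γ₀ ⊆ Elastic.regularWith Ω D ω α₀ β₀ γ₀ M₀ ∧
        (ω ^ 2 ≤ γ₀ * lam₁ / 8 →
          Elastic.admissible N α₀ β₀ γ₀ = Elastic.regularWith Ω D ω α₀ β₀ γ₀ M₀) ∧
        -- `DF` is Lipschitz continuous
        (∀ M : ℝ, LipschitzOnWith (C M) (fderiv ℝ (Elastic.forwardMap Ω D ω S))
          (Elastic.regularWith Ω D ω α₀ β₀ γ₀ M)) := by
  refine ⟨1 + (coercivityConst α₀ lam₁)⁻¹ * (1 + (27 + γ₀ * lam₁ / 2) * (2 / α₀ + 2 / γ₀)),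
    fun M => (2 * (27 + γ₀ * lam₁ / 2) ^ 2 * |M| ^ 3).toNNReal, ?_⟩
  intro N Ω D j₁ S ω hP hlam hω
  have hD := hP.isOpen_sub
  have hd := hP.disjoint_sub
  have hae := hP.ae_mem_iUnion (by linarith)
  have hB : ‖formCLM Ω hD hd ω‖ ≤ 27 + γ₀ * lam₁ / 2 :=
    (norm_formCLM_le hD hd ω).trans (by linarith)
  have hγ0 := hγ.1
  refine ⟨isOpen_regular hD hd ω α₀ β₀ γ₀, ?_, ?_, ?_,
    fun M => lipschitzOnWith_fderiv_forwardMap hD hd hB M⟩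
  · rintro p ⟨M, hp⟩
    have hwp := (wellPosedWith_iff hD hd ω M p).1 hp.2
    obtain ⟨Q, hQ, _⟩ := hwp.exists_solutionOp
    refine ⟨?_, pullbackParam (Hco Ω S) (formCLM Ω hD hd ω) Q,
      hasFDerivAt_forwardMap hD hd hp hQ, ?_⟩
    · rw [forwardMap_eq_pullback hD hd hwp hQ]
      exact isLocalDNMap_pullback hD hd hwp hQ
    · intro H ψ φ u v hu hv
      rw [isWeakSolution_iff hD hd] at hu hv
      rw [IsSolutionOp.eq hwp hQ hu, IsSolutionOp.eq hwp hQ hv]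
      rfl
  · rintro p ⟨hp, hK⟩
    subst hlam
    refine mem_regularWith_of_lower_bounds (s := 1) (R := γ₀⁻¹) hP.isOpen hP.isBounded hD hd hae
      (by norm_num) hα.1 hβ.1 hγ0 hB hp (fun j => ?_) (fun j => ?_) (fun j => ?_) ?_
    · linarith [(hK j).1]
    · linarith [(hK j).2.2.2.1]
    · exact (hK j).2.2.2.2.2
    · rw [inv_mul_le_iff₀ hγ0]
      linarith
  · intro hω'
    refine Subset.antisymm (fun p hp => ?_) fun p hp => hp.1
    subst hlam
    refine mem_regularWith_of_lower_bounds (s := 1 / 2) (R := 2 / γ₀) hP.isOpen hP.isBounded hD hd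
      hae le_rfl hα.1 hβ.1 hγ0 hB hp (fun j => ?_) (fun j => ?_) (fun j => ?_) ?_
    · linarith [(hp j).1]
    · linarith [(hp j).2.2.2.1]
    · exact (hp j).2.2.2.2.2.le
    · rw [div_mul_eq_mul_div, div_le_iff₀ hγ0]
      linarith
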